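/- Let $K=\mathbb R$ or $\mathbb C$, let $(\Omega,\mathcal F,P)$ be a probability space, and let $L^0(\mathcal F,K)$ be the ring of $P$-a.s. equivalence classes of $K$-valued $\mathcal F$-measurable random variables, with $L^0(\mathcal F)=L^0(\mathcal F,\mathbb R)$ ordered by a.s. inequality, $L^0_+(\mathcal F)=\{\xi\in L^0(\mathcal F):\xi\ge 0\}$, $L^0_{++}(\mathcal F)=\{\xi\in L^0(\mathcal F):\xi>0\text{ a.s.}\}$ and $\tilde I_A$ the class of the characteristic function of $A\in\mathcal F$. *Definitions.* A *random duality pair* $\langle X,Y\rangle$ over $K$ with base $(\Omega,\mathcal F,P)$ consists of two $L^0(\mathcal F,K)$-modules $X,Y$ and an $L^0(\mathcal F,K)$-bilinear map $\langle\cdot,\cdot\rangle:X\times Y\to L^0(\mathcal F,K)$ such that $\langle x,y\rangle=0$ for all $y\in Y$ iff $x=0$, and $\langle x,y\rangle=0$ for all $x\in X$ iff $y=0$. The module $X$ has the *countable concatenation property* if for every sequence $(x_n)$ in $X$ and every countable measurable partition $(A_n)$ of $\Omega$ there is $x\in X$ with $\tilde I_{A_n}x=\tilde I_{A_n}x_n$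 for all $n$; this $x$ is unique for a random duality pair and is written $\sum_n\tilde I_{A_n}x_n$. For $G\subset X$, the *countable concatenation hull* $H_{cc}(G)$ is the set of all $\sum_n\tilde I_{A_n}x_n$ with $(x_n)$ a sequence in $G$ and $(A_n)$ a countable measurable partition of $\Omega$. A set $B\subset X$ is *$L^0$-balanced* if $\eta B\subset B$ for all $\eta\in L^0(\mathcal F,K)$ with $|\eta|\le1$, and *$L^0$-convex* if $\xi x+(1-\xi)y\in B$ for all $x,y\in B$ and $\xi\in L^0(\mathcal F)$ with $0\le\xi\le1$; $\Gamma(A)$ is the smallest $L^0$-balanced and $L^0$-convex set containing $A$. For $A\subset X$ put $A^0=\{y\in Y:|\langle a,y\rangle|\le1\ \forall a\in A\}$ and $A^{00}=\{x\in X:|\langle x,y\rangle|\le1\ \forall y\in A^0\}$. An *$L^0$-seminorm* on $X$ is a map $p:X\to L^0_+(\mathcal F)$ with $p(\xi x)=|\xi|p(x)$ and $p(x+y)\le p(x)+p(y)$ for all $\xi\in L^0(\mathcal F,K)$ and $x,y\in X$. A family $\mathcal P$ of $L^0$-seminorms on $X$ such that $p(x)=0$ for all $p\in\mathcal P$ iff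 $x=0$ makes $X$ a *random locally convex module*; it induces the translation invariant *locally $L^0$-convex topology* $\mathcal T_c$ on $X$ for which the sets $\{x:\bigvee_{p\in Q}p(x)\le\varepsilon\}$, with $Q\subset\mathcal P$ finite and $\varepsilon\in L^0_{++}(\mathcal F)$, form a local base at $0$. In particular $|\cdot|$ induces $\mathcal T_c$ on $L^0(\mathcal F,K)$. A topology $\mathcal T$ on $X$ is *random compatible with $Y$* if it is induced in this way by some such family $\mathcal P$ and the continuous module homomorphisms from $(X,\mathcal T)$ to $(L^0(\mathcal F,K),\mathcal T_c)$ are exactly the maps $\langle\cdot,y\rangle$ with $y\in Y$. **Theorem 3.26 (Random bipolar theorem).** Let $\langle X,Y\rangle$ be a random duality pair over $K$ with base $(\Omega,\mathcal F,P)$ such that $X$ has the countable concatenation property. Then for every nonempty subset $A$ of $X$ and every topology $\mathcal T$ on $X$ that is random compatible with $Y$, $$A^{00}=[H_{cc}(\Gamma(A))]^-_{\mathcal T},$$ where $[\,\cdot\,]^-_{\mathcal T}$ denotes the $\mathcal T$-closure. -/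

import Mathlib

open MeasureTheory Topology

noncomputable section

namespace RandomDuality

/-- `L0 P K` is `L⁰(ℱ, K)`: classes, modulo `P`-almost sure equality, of `K`-valued random
variables on the probability space `(Ω, ℱ, P)`. -/
abbrev L0 {Ω : Type*} [MeasurableSpace Ω] (P : Measure Ω) (K : Type*) [TopologicalSpace K] :
    Type _ :=
  Ω →ₘ[P] K

/-- The pointwise ring structure on `L⁰(ℱ, K)`; sum, product, zero and one are those of Mathlib. -/
instance instCommRingL0 {Ω : Type*} [MeasurableSpace Ω] {P : Measure Ω} {K : Type*} [RCLike K] :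
    CommRing (L0 P K) where
  __ := (inferInstance : AddCommGroup (Ω →ₘ[P] K))
  __ := (inferInstance : CommMonoid (Ω →ₘ[P] K))
  left_distrib a b c := by
    apply AEEqFun.ext
    filter_upwards [AEEqFun.coeFn_mul a (b + c), AEEqFun.coeFn_add b c,
      AEEqFun.coeFn_add (a * b) (a * c), AEEqFun.coeFn_mul a b, AEEqFun.coeFn_mul a c]
      with ω h1 h2 h3 h4 h5
    simp only [h1, h2, h3, h4, h5, Pi.mul_apply, Pi.add_apply, mul_add]
  right_distrib a b c := by
    apply AEEqFun.ext
    filter_upwards [AEEqFun.coeFn_mul (a + b) c, AEEqFun.coeFn_add a b,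
      AEEqFun.coeFn_add (a * c) (b * c), AEEqFun.coeFn_mul a c, AEEqFun.coeFn_mul b c]
      with ω h1 h2 h3 h4 h5
    simp only [h1, h2, h3, h4, h5, Pi.mul_apply, Pi.add_apply, add_mul]
  zero_mul a := by
    apply AEEqFun.ext
    filter_upwards [AEEqFun.coeFn_mul 0 a, AEEqFun.coeFn_zero (α := Ω) (μ := P) (β := K)]
      with ω h1 h2
    simp only [h1, h2, Pi.mul_apply, Pi.zero_apply, zero_mul]
  mul_zero a := by
    apply AEEqFun.ext
    filter_upwards [AEEqFun.coeFn_mul a 0, AEEqFun.coeFn_zero (α := Ω) (μ := P) (β := K)]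
      with ω h1 h2
    simp only [h1, h2, Pi.mul_apply, Pi.zero_apply, mul_zero]

section L0

variable {Ω : Type*} [MeasurableSpace Ω] {P : Measure Ω} {K : Type*} [RCLike K]

/-- The modulus `|ξ| ∈ L⁰(ℱ)` of `ξ ∈ L⁰(ℱ, K)`. -/
def modulus (ξ : L0 P K) : L0 P ℝ :=
  AEEqFun.comp (fun z : K => ‖z‖) continuous_norm ξ

/-- A real random variable regarded as a `K`-valued one. -/
def ofRealL0 (K : Type*) [RCLike K] (ξ : L0 P ℝ) : L0 P K :=
  AEEqFun.comp (fun r : ℝ => (r : K)) RCLike.continuous_ofReal ξ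

/-- `ε ∈ L⁰₊₊(ℱ)`: `ε > 0` almost surely. -/
def IsStrictlyPos (ε : L0 P ℝ) : Prop :=
  ∀ᵐ ω ∂P, 0 < ε ω

/-- The class `Ĩ_A` of the characteristic function of a measurable set `A`. -/
def ind (P : Measure Ω) (K : Type*) [RCLike K] (A : Set Ω) (hA : MeasurableSet A) : L0 P K :=
  AEEqFun.mk (A.indicator fun _ => (1 : K))
    (stronglyMeasurable_const.indicator hA).aestronglyMeasurable

/-- The topology `𝒯_c` on `L⁰(ℱ, K)`: `G` is open iff each `ξ ∈ G` has some `ε ∈ L⁰₊₊(ℱ)` with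
`{ζ : |ζ - ξ| ≤ ε} ⊆ G`. -/
@[reducible]
def scalarTopology (P : Measure Ω) (K : Type*) [RCLike K] : TopologicalSpace (L0 P K) where
  IsOpen G := ∀ ξ ∈ G, ∃ ε : L0 P ℝ, IsStrictlyPos ε ∧ ∀ η : L0 P K, modulus η ≤ ε → ξ + η ∈ G
  isOpen_univ := fun _ _ =>
    ⟨1, by
      filter_upwards [AEEqFun.coeFn_one (α := Ω) (μ := P) (β := ℝ)] with ω h
      simp [h], fun _ _ => Set.mem_univ _⟩
  isOpen_inter := by
    intro G H hG hH ξ hξ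
    obtain ⟨ε, hε, h⟩ := hG ξ hξ.1
    obtain ⟨δ, hδ, h'⟩ := hH ξ hξ.2
    refine ⟨ε ⊓ δ, ?_, fun η hη =>
      ⟨h η (hη.trans inf_le_left), h' η (hη.trans inf_le_right)⟩⟩
    filter_upwards [hε, hδ, AEEqFun.coeFn_inf ε δ] with ω h1 h2 h3
    rw [h3]
    exact lt_inf_iff.2 ⟨h1, h2⟩
  isOpen_sUnion := by
    intro S hS ξ ⟨G, hG, hξ⟩
    obtain ⟨ε, hε, h⟩ := hS G hG ξ hξ
    exact ⟨ε, hε, fun η hη => ⟨G, hG, h η hη⟩⟩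

end L0

/-- A countable partition `{Aₙ}` of `Ω` to `ℱ` (some of the `Aₙ` may be empty). -/
structure CountablePartition (Ω : Type*) [MeasurableSpace Ω] where
  part : ℕ → Set Ω
  measurable : ∀ n, MeasurableSet (part n)
  disjoint : Pairwise fun m n => Disjoint (part m) (part n)
  iUnion_eq : ⋃ n, part n = Set.univ

section Modules

variable {Ω : Type*} [MeasurableSpace Ω] {P : Measure Ω} {K : Type*} [RCLike K]
  {X : Type*} [AddCommGroup X] [Module (L0 P K) X]
  {Y : Type*} [AddCommGroup Y] [Module (L0 P K) Y]

/-- `x = ∑ₙ Ĩ_{Aₙ} xₙ`, that is, `Ĩ_{Aₙ} x = Ĩ_{Aₙ} xₙ` for every `n`. -/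
def IsConcatenation (P : Measure Ω) (K : Type*) [RCLike K] {X : Type*} [AddCommGroup X]
    [Module (L0 P K) X] (A : CountablePartition Ω) (u : ℕ → X) (x : X) : Prop :=
  ∀ n, ind P K (A.part n) (A.measurable n) • x = ind P K (A.part n) (A.measurable n) • u n

/-- The module `X` has the countable concatenation property. -/
def HasCountableConcatenation (P : Measure Ω) (K : Type*) [RCLike K] (X : Type*) [AddCommGroup X]
    [Module (L0 P K) X] : Prop :=
  ∀ (A : CountablePartition Ω) (u : ℕ → X), ∃ x : X, IsConcatenation P K A u x

/-- The countable concatenation hull `H_cc(G)` of a subset `G` of `X`. -/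
def ccHull (P : Measure Ω) (K : Type*) [RCLike K] {X : Type*} [AddCommGroup X]
    [Module (L0 P K) X] (G : Set X) : Set X :=
  {x | ∃ (A : CountablePartition Ω) (u : ℕ → X), (∀ n, u n ∈ G) ∧ IsConcatenation P K A u x}

/-- `L⁰`-balanced sets. -/
def IsL0Balanced (P : Measure Ω) (K : Type*) [RCLike K] {X : Type*} [AddCommGroup X]
    [Module (L0 P K) X] (B : Set X) : Prop :=
  ∀ η : L0 P K, modulus η ≤ 1 → ∀ x ∈ B, η • x ∈ B

/-- `L⁰`-convex sets. -/
def IsL0Convex (P : Measure Ω) (K : Type*) [RCLike K] {X : Type*} [AddCommGroup X]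
    [Module (L0 P K) X] (B : Set X) : Prop :=
  ∀ x ∈ B, ∀ y ∈ B, ∀ ξ : L0 P ℝ, 0 ≤ ξ → ξ ≤ 1 →
    ofRealL0 K ξ • x + (1 - ofRealL0 K ξ) • y ∈ B

/-- `Γ(A)`: the smallest `L⁰`-balanced and `L⁰`-convex set containing `A`. -/
def balancedConvexHull (P : Measure Ω) (K : Type*) [RCLike K] {X : Type*} [AddCommGroup X]
    [Module (L0 P K) X] (A : Set X) : Set X :=
  ⋂₀ {B | A ⊆ B ∧ IsL0Balanced P K B ∧ IsL0Convex P K B}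

/-- An `L⁰`-seminorm on `X`. -/
structure L0Seminorm (P : Measure Ω) (K : Type*) [RCLike K] (X : Type*) [AddCommGroup X]
    [Module (L0 P K) X] where
  toFun : X → L0 P ℝ
  nonneg : ∀ x, 0 ≤ toFun x
  smul : ∀ (ξ : L0 P K) (x : X), toFun (ξ • x) = modulus ξ * toFun x
  add_le : ∀ x y, toFun (x + y) ≤ toFun x + toFun y

/-- `‖x‖_Q = ⋁ {‖x‖ : ‖·‖ ∈ Q}` for a finite set `Q` of `L⁰`-seminorms; the supremum is taken in
`L⁰₊(ℱ)`, so it is `0` for empty `Q`. -/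
def finSup (Q : Finset (L0Seminorm P K X)) (x : X) : L0 P ℝ :=
  ((Q.sup fun p => (⟨p.toFun x, p.nonneg x⟩ : Set.Ici (0 : L0 P ℝ)) : Set.Ici (0 : L0 P ℝ)) :
    L0 P ℝ)

/-- `(X, 𝒮)` is a random locally convex module: the members of `𝒮` are `L⁰`-seminorms, and the
supremum of the `‖x‖`, `‖·‖ ∈ 𝒮` (a family of nonnegative elements), vanishes iff `x = 0`. -/
def IsRLCModule (𝒮 : Set (L0Seminorm P K X)) : Prop :=
  ∀ x : X, (∀ p ∈ 𝒮, p.toFun x = 0) ↔ x = 0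

/-- The locally `L⁰`-convex topology `𝒯_c` induced by `𝒮`: the translation invariant topology for
which the sets `{x : ‖x‖_Q ≤ ε}`, with `Q ⊆ 𝒮` finite and `ε ∈ L⁰₊₊(ℱ)`, form a local base at
`0`. -/
@[reducible]
def inducedTopology (𝒮 : Set (L0Seminorm P K X)) : TopologicalSpace X where
  IsOpen G := ∀ x ∈ G, ∃ (Q : Finset (L0Seminorm P K X)) (ε : L0 P ℝ),
    (Q : Set (L0Seminorm P K X)) ⊆ 𝒮 ∧ IsStrictlyPos ε ∧ ∀ z : X, finSup Q z ≤ ε → x + z ∈ G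
  isOpen_univ := fun _ _ =>
    ⟨∅, 1, by simp, by
      filter_upwards [AEEqFun.coeFn_one (α := Ω) (μ := P) (β := ℝ)] with ω h
      simp [h], fun _ _ => Set.mem_univ _⟩
  isOpen_inter := by
    classical
    intro G H hG hH x hx
    obtain ⟨Q, ε, hQ, hε, h⟩ := hG x hx.1
    obtain ⟨R, δ, hR, hδ, h'⟩ := hH x hx.2
    refine ⟨Q ∪ R, ε ⊓ δ, by simp [hQ, hR], ?_, fun z hz => ⟨h z ?_, h' z ?_⟩⟩
    · filter_upwards [hε, hδ, AEEqFun.coeFn_inf ε δ] with ω h1 h2 h3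
      rw [h3]
      exact lt_inf_iff.2 ⟨h1, h2⟩
    · exact le_trans (Subtype.coe_le_coe.2 (Finset.sup_mono Finset.subset_union_left))
        (hz.trans inf_le_left)
    · exact le_trans (Subtype.coe_le_coe.2 (Finset.sup_mono Finset.subset_union_right))
        (hz.trans inf_le_right)
  isOpen_sUnion := by
    intro S hS x ⟨G, hG, hx⟩
    obtain ⟨Q, ε, hQ, hε, h⟩ := hS G hG x hx
    exact ⟨Q, ε, hQ, hε, fun z hz => ⟨G, hG, h z hz⟩⟩

/-- The random conjugate space `(X, 𝒯)*_c`: the continuous module homomorphisms from `(X, 𝒯)` to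
`(L⁰(ℱ, K), 𝒯_c)`. -/
def conjugateSpace (P : Measure Ω) (K : Type*) [RCLike K] {X : Type*} [AddCommGroup X]
    [Module (L0 P K) X] (𝒯 : TopologicalSpace X) : Set (X →ₗ[L0 P K] L0 P K) :=
  {f | Continuous[𝒯, scalarTopology P K] f}

/-- `⟨X, Y⟩` is a random duality pair with respect to the `L⁰`-bilinear function `b`. -/
def IsRandomDualityPair (b : X →ₗ[L0 P K] Y →ₗ[L0 P K] L0 P K) : Prop :=
  (∀ x : X, (∀ y : Y, b x y = 0) ↔ x = 0) ∧ (∀ y : Y, (∀ x : X, b x y = 0) ↔ y = 0)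

/-- `𝒯` is a random compatible locally `L⁰`-convex topology on `X` with `Y`: it is induced by a
family of `L⁰`-seminorms making `X` a random locally convex module whose random conjugate space
is `Y`, each `y ∈ Y` being identified with `⟨·, y⟩`. -/
def IsRandomCompatible (b : X →ₗ[L0 P K] Y →ₗ[L0 P K] L0 P K) (𝒯 : TopologicalSpace X) : Prop :=
  ∃ 𝒮 : Set (L0Seminorm P K X), IsRLCModule 𝒮 ∧ 𝒯 = inducedTopology 𝒮 ∧
    conjugateSpace P K 𝒯 = Set.range fun y : Y => b.flip y

/-- The polar in `Y` of a subset `A` of `X`. The polar in `X` of a subset of `Y` is obtained from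
`b.flip`. -/
def polar (b : X →ₗ[L0 P K] Y →ₗ[L0 P K] L0 P K) (A : Set X) : Set Y :=
  {y | ∀ a ∈ A, modulus (b a y) ≤ 1}

end Modules

end RandomDuality

end

/-! One inclusion is soft: for `y` in the polar of `A` the set where `|⟨x, y⟩| ≤ 1` is balanced,
convex, stable under countable concatenation and closed, so it contains the closed hull.

For the other, let `G = H_cc(Γ(A))` and let `x` lie outside its closure, so that some finite
supremum `N` of seminorms and some `ε > 0` satisfy `N (x - g) ≤ ε` for no `g ∈ G`. The gauge of `G`
may be infinite, so it is replaced by its infimal convolution with `C N`, where `C = 2 / ε`: `p z`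
is the essential infimum of `l + C N (z - l g)` over `l ≥ 0` and `g ∈ G`. This is an `L⁰`-seminorm
with `p ≤ C N` and `p ≤ 1` on `G`. A Hahn–Banach functional `f` with `|f| ≤ p` and `|f x| = p x` is
continuous, hence equals `⟨·, y⟩` with `y ∈ A⁰`. It remains to exclude `p x ≤ 1`. In that case a
sequence of gauge values attains the infimum, almost every `ω` has a term with value below `1 + δ`,
and the corresponding points of `G`, glued along a countable partition, give a `g ∈ G` with `N (x -
g) ≤ ε` (`exists_mem_sub_le_of_isGLB`). This gluing is why the concatenation hull appears.

Hahn–Banach is proved over an abstract ordered ring with infima and quasi-inverses. Scalars need not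
be invertible and a functional cannot be extended one dimension at a time, so Zorn's lemma is
applied to sublinear maps, whose minimal elements are linear. -/

/-- A lattice ordered commutative ring which is Dedekind complete, and in which every nonnegative
element has a nonnegative quasi-inverse. -/
class DedekindRegularRing (R : Type*) [CommRing R] [Lattice R] : Prop where
  exists_isGLB : ∀ S : Set R, S.Nonempty → BddBelow S → ∃ a, IsGLB S a
  exists_quasiInv : ∀ r : R, 0 ≤ r → ∃ s, 0 ≤ s ∧ r * s ≤ 1 ∧ r * s * r = r

/-- Sublinear maps from a module to an ordered ring. Positive homogeneity is only required as an
inequality; over a `DedekindRegularRing` equality follows. -/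
structure IsSublinear {R X : Type*} [CommRing R] [Lattice R] [AddCommGroup X] [Module R X]
    (p : X → R) : Prop where
  add_le : ∀ x y, p (x + y) ≤ p x + p y
  smul_le : ∀ (r : R) (x : X), 0 ≤ r → p (r • x) ≤ r * p x

/-! ### Hahn–Banach over ordered rings, by minimal sublinear maps -/

section HahnBanach

variable {R X : Type*} [CommRing R] [Lattice R] [IsOrderedRing R]
  [AddCommGroup X] [Module R X] {p : X → R}

theorem IsSublinear.map_zero (hp : IsSublinear p) : p 0 = 0 := by
  apply le_antisymm
  · simpa using hp.smul_le 0 0 le_rfl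
  · have := hp.add_le 0 0
    rw [add_zero] at this
    exact (le_add_iff_nonneg_left _).1 this

theorem IsSublinear.neg_le (hp : IsSublinear p) (x : X) : -p (-x) ≤ p x := by
  have := hp.add_le x (-x)
  rw [add_neg_cancel, hp.map_zero] at this
  exact neg_le_iff_add_nonneg.2 this

/-- Split `x = r • x + (1 - r) • x` and bound the second term by `(1 - r) * p x`; the sign of `r`
plays no role. -/
theorem IsSublinear.mul_le_of_le_one (hp : IsSublinear p) {r : R} (h1 : r ≤ 1) (x : X) :
    r * p x ≤ p (r • x) := by
  have h := hp.add_le (r • x) ((1 - r) • x)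
  rw [← add_smul, add_sub_cancel, one_smul] at h
  have h' := h.trans (add_le_add_right (hp.smul_le (1 - r) x (sub_nonneg.2 h1)) _)
  rw [sub_mul, one_mul] at h'
  have h'' := sub_nonneg.2 h'
  rw [← sub_nonneg]
  convert h'' using 1
  ring

variable [DedekindRegularRing R]

/-- If `s` is a quasi-inverse of `r`, then `r * s` is an idempotent acting as the support of `r`. It
replaces division: undo `r` by `s` on the support, then multiply back. -/
theorem IsSublinear.map_smul (hp : IsSublinear p) {r : R} (h0 : 0 ≤ r) (x : X) :
    p (r • x) = r * p x := by
  refine le_antisymm (hp.smul_le r x h0) ?_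
  obtain ⟨s, hs, hrs, hrsr⟩ := DedekindRegularRing.exists_quasiInv r h0
  have h1 : (r * s) * p x ≤ s * p (r • x) := by
    refine (hp.mul_le_of_le_one hrs x).trans ?_
    rw [mul_comm r s, mul_smul]
    exact hp.smul_le s _ hs
  have h2 : (r * s) * p (r • x) ≤ p (r • x) := by
    have := hp.mul_le_of_le_one hrs (r • x)
    rwa [smul_smul, hrsr] at this
  calc r * p x = r * (r * s * p x) := by
        rw [← mul_assoc r, mul_comm r (r * s), hrsr]
    _ ≤ r * (s * p (r • x)) := mul_le_mul_of_nonneg_left h1 h0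
    _ = r * s * p (r • x) := by ring
    _ ≤ _ := h2

/-- On the support of `r` one divides by `r`; off it `r * s` vanishes, so there `c ≤ 0`, which takes
one element of `S` to see. -/
theorem IsGLB.le_mul_of_nonneg {S : Set R} {a r c : R} (ha : IsGLB S a) (hS : S.Nonempty)
    (hr : 0 ≤ r) (hc : ∀ s ∈ S, c ≤ r * s) : c ≤ r * a := by
  obtain ⟨t, ht, hrt, hrtr⟩ := DedekindRegularRing.exists_quasiInv r hr
  have hrt' : 0 ≤ 1 - r * t := sub_nonneg.2 hrt
  have h1 : t * c + (1 - r * t) * a ≤ a := by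
    refine ha.2 fun s hs => ?_
    calc t * c + (1 - r * t) * a ≤ t * (r * s) + (1 - r * t) * s :=
          add_le_add (mul_le_mul_of_nonneg_left (hc s hs) ht)
            (mul_le_mul_of_nonneg_left (ha.1 hs) hrt')
      _ = s := by ring
  obtain ⟨s, hs⟩ := hS
  have h2 : (1 - r * t) * c ≤ 0 := by
    have := mul_le_mul_of_nonneg_left (hc s hs) hrt'
    refine this.trans_eq ?_
    rw [← mul_assoc, sub_mul, one_mul, hrtr, sub_self, zero_mul]
  have h3 := mul_le_mul_of_nonneg_left h1 hr
  have h4 := add_le_add h2 h3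
  have e : (1 - r * t) * c + r * (t * c + (1 - r * t) * a) = c + (r - r * t * r) * a := by ring
  rwa [e, hrtr, sub_self, zero_mul, add_zero, zero_add] at h4

/-- The pointwise infimum of a chain of sublinear maps with a common sublinear bound is attained
by a sublinear map. -/
theorem IsSublinear.exists_chain_lowerBound {c : Set (X → R)}
    (hc : ∀ q ∈ c, IsSublinear q) (hchain : IsChain (· ≤ ·) c) {q₀ : X → R} (hq₀ : q₀ ∈ c) :
    ∃ q : X → R, IsSublinear q ∧ ∀ q' ∈ c, q ≤ q' := by
  have hbdd (x : X) : BddBelow ((fun q : X → R => q x) '' c) := by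
    -- For `q ≤ q₀` the bound is `-q₀ (-x) ≤ -q (-x) ≤ q x`; otherwise `q₀ x ≤ q x`.
    refine ⟨-q₀ (-x) ⊓ q₀ x, ?_⟩
    rintro _ ⟨q, hq, rfl⟩
    rcases hchain.total hq hq₀ with h | h
    · exact inf_le_left.trans ((neg_le_neg (h (-x))).trans ((hc q hq).neg_le x))
    · exact inf_le_right.trans (h x)
  have hne (x : X) : ((fun q : X → R => q x) '' c).Nonempty := ⟨_, q₀, hq₀, rfl⟩
  choose m hm using fun x => DedekindRegularRing.exists_isGLB _ (hne x) (hbdd x)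
  refine ⟨m, ⟨fun x y => ?_, fun r x hr => ?_⟩, fun q hq x => (hm x).1 ⟨q, hq, rfl⟩⟩
  · rw [← sub_le_iff_le_add]
    refine (hm x).2 ?_
    rintro _ ⟨q₁, hq₁, rfl⟩
    rw [sub_le_comm]
    refine (hm y).2 ?_
    rintro _ ⟨q₂, hq₂, rfl⟩
    rw [sub_le_iff_le_add']
    -- The infima at `x` and at `y` come from different members of the chain; the smaller member
    -- serves for both.
    rcases hchain.total hq₁ hq₂ with h | h
    · exact ((hm _).1 ⟨q₁, hq₁, rfl⟩).trans (((hc q₁ hq₁).add_le x y).trans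
        (add_le_add_right (h y) _))
    · exact ((hm _).1 ⟨q₂, hq₂, rfl⟩).trans (((hc q₂ hq₂).add_le x y).trans
        (add_le_add_left (h x) _))
  · refine (hm x).le_mul_of_nonneg (hne x) hr ?_
    rintro _ ⟨q, hq, rfl⟩
    exact ((hm _).1 ⟨q, hq, rfl⟩).trans ((hc q hq).smul_le r x hr)

/-- Below a sublinear map `q` there is a sublinear map whose value at `-z` is at most `-q z`. -/
theorem IsSublinear.exists_le_neg {q : X → R} (hq : IsSublinear q) (z : X) :
    ∃ q' : X → R, IsSublinear q' ∧ q' ≤ q ∧ ∀ x, q' x ≤ q (x + z) - q z := by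
  -- The new map is the infimum over `r ≥ 0` of `q (x + r • z) - r * q z`; `r = 0` gives `q' ≤ q`
  -- and `r = 1` the last claim.
  set S : X → Set R := fun x => {a | ∃ r : R, 0 ≤ r ∧ a = q (x + r • z) - r * q z} with hS
  have hbdd (x : X) : BddBelow (S x) := by
    refine ⟨-q (-x), ?_⟩
    rintro _ ⟨r, hr, rfl⟩
    have h := hq.add_le (x + r • z) (-x)
    rw [add_neg_cancel_comm, hq.map_smul hr] at h
    rw [neg_le_iff_add_nonneg, ← sub_nonneg] at *
    convert h using 1
    ring
  have hne (x : X) : (S x).Nonempty := ⟨_, 0, le_rfl, rfl⟩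
  choose m hm using fun x => DedekindRegularRing.exists_isGLB _ (hne x) (hbdd x)
  refine ⟨m, ⟨fun x y => ?_, fun r x hr => ?_⟩, fun x => (hm x).1 ⟨0, le_rfl, by simp⟩,
    fun x => (hm x).1 ⟨1, zero_le_one, by simp⟩⟩
  · rw [← sub_le_iff_le_add]
    refine (hm x).2 ?_
    rintro _ ⟨r, hr, rfl⟩
    rw [sub_le_comm]
    refine (hm y).2 ?_
    rintro _ ⟨s, hs, rfl⟩
    rw [sub_le_iff_le_add']
    refine ((hm _).1 ⟨r + s, add_nonneg hr hs, rfl⟩).trans ?_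
    have h := hq.add_le (x + r • z) (y + s • z)
    have e : x + y + (r + s) • z = x + r • z + (y + s • z) := by rw [add_smul]; abel
    rw [e, ← sub_nonneg] at *
    convert sub_nonneg.2 h using 1
    ring
  · refine (hm x).le_mul_of_nonneg (hne x) hr ?_
    rintro _ ⟨s, hs, rfl⟩
    refine ((hm _).1 ⟨r * s, mul_nonneg hr hs, rfl⟩).trans ?_
    rw [mul_smul, ← smul_add, hq.map_smul hr]
    exact le_of_eq (by ring)

/-- A minimal sublinear map is linear. -/
theorem IsSublinear.exists_linearMap_of_minimal {q : X → R} (hq : IsSublinear q)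
    (hmin : ∀ q' : X → R, IsSublinear q' → q' ≤ q → q ≤ q') :
    ∃ f : X →ₗ[R] R, ∀ x, f x = q x := by
  have hadd (x z : X) : q (x + z) = q x + q z := by
    refine le_antisymm (hq.add_le x z) ?_
    -- Minimality gives `q x ≤ q' x ≤ q (x + z) - q z`, which is superadditivity.
    obtain ⟨q', hq', hle, h⟩ := hq.exists_le_neg z
    exact le_sub_iff_add_le.1 ((hmin q' hq' hle x).trans (h x))
  have hneg (x : X) : q (-x) = -q x := by
    rw [eq_neg_iff_add_eq_zero, ← hadd, neg_add_cancel, hq.map_zero]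
  refine ⟨{ toFun := q, map_add' := hadd, map_smul' := fun r x => ?_ }, fun x => rfl⟩
  have h := posPart_sub_negPart r
  have h1 : r • x = r⁺ • x + -(r⁻ • x) := by rw [← sub_eq_add_neg, ← sub_smul, h]
  rw [h1, hadd, hneg, hq.map_smul (posPart_nonneg r), hq.map_smul (negPart_nonneg r),
    ← sub_eq_add_neg, ← sub_mul, h, RingHom.id_apply, smul_eq_mul]

/-- The Hahn–Banach theorem for modules over a Dedekind complete regular ordered ring. -/
theorem IsSublinear.exists_linearMap_le (hp : IsSublinear p) (z : X) :
    ∃ f : X →ₗ[R] R, (∀ x, f x ≤ p x) ∧ f z = p z := by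
  -- Starting Zorn's lemma below `p'` instead of `p` forces `f (-z) ≤ -p z`, hence equality at `z`.
  obtain ⟨p', hp', hle, hz⟩ := hp.exists_le_neg z
  obtain ⟨q, hqp, hq⟩ := zorn_le_nonempty₀ (α := (X → R)ᵒᵈ)
    {q | IsSublinear (OrderDual.ofDual q)} (fun c hc hchain q₀ hq₀ => by
      obtain ⟨m, hm, hmle⟩ := IsSublinear.exists_chain_lowerBound
        (c := OrderDual.toDual ⁻¹' c) (fun q hq => hc hq) hchain.symm hq₀
      exact ⟨OrderDual.toDual m, hm, fun q' hq' => hmle _ hq'⟩) (OrderDual.toDual p') hp'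
  obtain ⟨f, hf⟩ := IsSublinear.exists_linearMap_of_minimal hq.prop
    (fun q' hq' hle => hq.le_of_ge (y := OrderDual.toDual q') hq' hle)
  have hfp' (x : X) : f x ≤ p' x := (hf x).trans_le (hqp x)
  refine ⟨f, fun x => (hfp' x).trans (hle x), le_antisymm ((hfp' z).trans (hle z)) ?_⟩
  have h := (hfp' (-z)).trans (hz (-z))
  rw [neg_add_cancel, hp.map_zero, zero_sub, map_neg] at h
  exact neg_le_neg_iff.1 h

end HahnBanach

namespace RandomDuality

variable {Ω : Type*} [MeasurableSpace Ω] {P : Measure Ω} {K : Type*} [RCLike K]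

/-! ### Almost sure calculus in `L⁰` -/

theorem coeFn_modulus (ξ : L0 P K) : ∀ᵐ ω ∂P, modulus ξ ω = ‖ξ ω‖ :=
  AEEqFun.coeFn_comp _ _ _

theorem coeFn_ofRealL0 (ξ : L0 P ℝ) : ∀ᵐ ω ∂P, ofRealL0 K ξ ω = (ξ ω : K) :=
  AEEqFun.coeFn_comp _ _ _

theorem coeFn_ind (A : Set Ω) (hA : MeasurableSet A) :
    ∀ᵐ ω ∂P, ind P K A hA ω = A.indicator (fun _ => (1 : K)) ω :=
  AEEqFun.coeFn_mk _ _

theorem coeFn_zero' : ∀ᵐ ω ∂P, (0 : L0 P K) ω = 0 := AEEqFun.coeFn_zero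

theorem coeFn_one' : ∀ᵐ ω ∂P, (1 : L0 P K) ω = 1 := AEEqFun.coeFn_one

theorem coeFn_add' (ξ η : L0 P K) : ∀ᵐ ω ∂P, (ξ + η) ω = ξ ω + η ω := AEEqFun.coeFn_add ξ η

theorem coeFn_sub' (ξ η : L0 P K) : ∀ᵐ ω ∂P, (ξ - η) ω = ξ ω - η ω := AEEqFun.coeFn_sub ξ η

theorem coeFn_mul' (ξ η : L0 P K) : ∀ᵐ ω ∂P, (ξ * η) ω = ξ ω * η ω := AEEqFun.coeFn_mul ξ η

theorem le_iff_ae {ξ η : L0 P ℝ} : ξ ≤ η ↔ ∀ᵐ ω ∂P, ξ ω ≤ η ω := AEEqFun.coeFn_le.symm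

theorem nonneg_iff_ae {ξ : L0 P ℝ} : 0 ≤ ξ ↔ ∀ᵐ ω ∂P, 0 ≤ ξ ω := by
  rw [le_iff_ae]
  have := coeFn_zero' (P := P) (K := ℝ)
  constructor <;> intro h <;> filter_upwards [h, this] with ω h1 h2
  · rwa [h2] at h1
  · rwa [h2]

theorem le_one_iff_ae {ξ : L0 P ℝ} : ξ ≤ 1 ↔ ∀ᵐ ω ∂P, ξ ω ≤ 1 := by
  rw [le_iff_ae]
  have := coeFn_one' (P := P) (K := ℝ)
  constructor <;> intro h <;> filter_upwards [h, this] with ω h1 h2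
  · rwa [h2] at h1
  · rwa [h2]

theorem modulus_le_iff_ae {ξ : L0 P K} {η : L0 P ℝ} :
    modulus ξ ≤ η ↔ ∀ᵐ ω ∂P, ‖ξ ω‖ ≤ η ω := by
  rw [le_iff_ae]
  have := coeFn_modulus ξ
  constructor <;> intro h <;> filter_upwards [h, this] with ω h1 h2
  · rwa [h2] at h1
  · rwa [h2]

theorem modulus_le_one_iff_ae {ξ : L0 P K} : modulus ξ ≤ 1 ↔ ∀ᵐ ω ∂P, ‖ξ ω‖ ≤ 1 := by
  rw [modulus_le_iff_ae]
  have := coeFn_one' (P := P) (K := ℝ)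
  constructor <;> intro h <;> filter_upwards [h, this] with ω h1 h2
  · rwa [h2] at h1
  · rwa [h2]

/-- The pointwise inverse, with `0⁻¹ = 0`. -/
noncomputable def invL0 (ξ : L0 P K) : L0 P K :=
  AEEqFun.mk (fun ω => (ξ ω)⁻¹) ξ.aestronglyMeasurable.inv₀

theorem coeFn_invL0 (ξ : L0 P K) : ∀ᵐ ω ∂P, invL0 ξ ω = (ξ ω)⁻¹ := AEEqFun.coeFn_mk _ _

instance : IsOrderedRing (L0 P ℝ) where
  add_le_add_left a b h c := by
    rw [le_iff_ae] at *
    filter_upwards [h, coeFn_add' a c, coeFn_add' b c] with ω h h1 h2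
    rw [h1, h2]
    linarith
  zero_le_one := by
    rw [nonneg_iff_ae]
    filter_upwards [coeFn_one' (P := P) (K := ℝ)] with ω h
    rw [h]
    exact zero_le_one
  mul_le_mul_of_nonneg_left a ha b c h := by
    rw [nonneg_iff_ae] at ha
    rw [le_iff_ae] at *
    filter_upwards [h, ha, coeFn_mul' a b, coeFn_mul' a c] with ω h h0 h1 h2
    rw [h1, h2]
    exact mul_le_mul_of_nonneg_left h h0
  mul_le_mul_of_nonneg_right a ha b c h := by
    rw [nonneg_iff_ae] at ha
    rw [le_iff_ae] at *
    filter_upwards [h, ha, coeFn_mul' b a, coeFn_mul' c a] with ω h h0 h1 h2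
    rw [h1, h2]
    exact mul_le_mul_of_nonneg_right h h0

/-! ### Essential infima and Dedekind completeness -/

/-- The class of the pointwise infimum of a sequence. -/
noncomputable def seqInf (u : ℕ → L0 P ℝ) : L0 P ℝ :=
  AEEqFun.mk (fun ω => ⨅ n, u n ω) (Measurable.iInf fun n => (u n).measurable).aestronglyMeasurable

theorem coeFn_seqInf (u : ℕ → L0 P ℝ) : ∀ᵐ ω ∂P, seqInf u ω = ⨅ n, u n ω :=
  AEEqFun.coeFn_mk _ _

theorem ae_bddBelow_range {S : Set (L0 P ℝ)} (hS : BddBelow S) {u : ℕ → L0 P ℝ}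
    (hu : ∀ n, u n ∈ S) : ∀ᵐ ω ∂P, BddBelow (Set.range fun n => u n ω) := by
  obtain ⟨c, hc⟩ := hS
  filter_upwards [ae_all_iff.2 fun n => le_iff_ae.1 (hc (hu n))] with ω h
  exact ⟨c ω, by rintro _ ⟨n, rfl⟩; exact h n⟩

theorem seqInf_le {S : Set (L0 P ℝ)} (hS : BddBelow S) {u : ℕ → L0 P ℝ}
    (hu : ∀ n, u n ∈ S) (n : ℕ) : seqInf u ≤ u n := by
  rw [le_iff_ae]
  filter_upwards [ae_bddBelow_range hS hu, coeFn_seqInf u] with ω h h1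
  rw [h1]
  exact ciInf_le h n

theorem le_seqInf {u : ℕ → L0 P ℝ} {c : L0 P ℝ} (h : ∀ n, c ≤ u n) : c ≤ seqInf u := by
  rw [le_iff_ae]
  filter_upwards [ae_all_iff.2 fun n => le_iff_ae.1 (h n), coeFn_seqInf u] with ω h h1
  rw [h1]
  exact le_ciInf h

theorem integrable_arctan [IsFiniteMeasure P] (ξ : L0 P ℝ) :
    Integrable (fun ω => Real.arctan (ξ ω)) P := by
  refine Integrable.of_bound (C := Real.pi / 2)
    (Real.continuous_arctan.comp_aestronglyMeasurable ξ.aestronglyMeasurable)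
    (Filter.Eventually.of_forall fun ω => ?_)
  rw [Real.norm_eq_abs, abs_le]
  exact ⟨(Real.neg_pi_div_two_lt_arctan _).le, (Real.arctan_lt_pi_div_two _).le⟩

theorem integral_arctan_mono [IsFiniteMeasure P] {ξ η : L0 P ℝ} (h : ξ ≤ η) :
    ∫ ω, Real.arctan (ξ ω) ∂P ≤ ∫ ω, Real.arctan (η ω) ∂P := by
  refine integral_mono_ae (integrable_arctan ξ) (integrable_arctan η) ?_
  filter_upwards [le_iff_ae.1 h] with ω h
  exact Real.arctan_strictMono.monotone h

/-- Since `arctan` is bounded and strictly increasing, `∫ arctan ξ` is a finite, strictly monotone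
functional of `ξ`: ordered elements with equal integrals coincide. -/
theorem le_of_integral_arctan_le [IsFiniteMeasure P] {ξ η : L0 P ℝ} (h : ξ ≤ η)
    (hi : ∫ ω, Real.arctan (η ω) ∂P ≤ ∫ ω, Real.arctan (ξ ω) ∂P) : η ≤ ξ := by
  have h0 : 0 ≤ᵐ[P] fun ω => Real.arctan (η ω) - Real.arctan (ξ ω) := by
    filter_upwards [le_iff_ae.1 h] with ω h
    exact sub_nonneg.2 (Real.arctan_strictMono.monotone h)
  have h1 := (integral_eq_zero_iff_of_nonneg_ae h0
    ((integrable_arctan η).sub (integrable_arctan ξ))).1 (le_antisymm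
      (by rw [integral_sub (integrable_arctan η) (integrable_arctan ξ)]; linarith)
      (integral_nonneg_of_ae h0))
  rw [le_iff_ae]
  filter_upwards [h1] with ω h1
  exact (Real.arctan_injective (sub_eq_zero.1 h1)).le

/-- The essential infimum of a bounded below family of random variables exists, and is the
infimum of a sequence in the family. -/
theorem exists_isGLB_seqInf [IsFiniteMeasure P] {S : Set (L0 P ℝ)} (hne : S.Nonempty)
    (hS : BddBelow S) : ∃ u : ℕ → L0 P ℝ, (∀ n, u n ∈ S) ∧ IsGLB S (seqInf u) := by
  -- Minimising over sequences instead of single elements makes the minimum attained, because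
  -- countably many sequences merge into one; `S` need not be directed.
  set J : (ℕ → S) → ℝ := fun u => ∫ ω, Real.arctan (seqInf (fun n => (u n : L0 P ℝ)) ω) ∂P with hJ
  obtain ⟨s₀, hs₀⟩ := hne
  have hbdd : BddBelow (Set.range J) := by
    obtain ⟨c, hc⟩ := hS
    refine ⟨∫ ω, Real.arctan (c ω) ∂P, ?_⟩
    rintro _ ⟨u, rfl⟩
    exact integral_arctan_mono (le_seqInf fun n => hc (u n).2)
  have hneJ : (Set.range J).Nonempty := ⟨_, fun _ => ⟨s₀, hs₀⟩, rfl⟩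
  obtain ⟨j, -, hj, hjJ⟩ := exists_seq_tendsto_sInf hneJ hbdd
  choose v hv using hjJ
  set u : ℕ → S := fun n => v n.unpair.1 n.unpair.2 with hu
  have huS (n : ℕ) : (u n : L0 P ℝ) ∈ S := (u n).2
  have huv (k : ℕ) : J u ≤ j k := by
    rw [← hv k]
    refine integral_arctan_mono (le_seqInf fun n => ?_)
    have := seqInf_le hS huS (Nat.pair k n)
    simpa [hu] using this
  have hJu : J u ≤ sInf (Set.range J) := ge_of_tendsto' hj huv
  refine ⟨fun n => u n, huS, fun s hs => ?_, fun c hc => le_seqInf fun n => hc (huS n)⟩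
  -- Prepending `s` to the optimal sequence cannot lower the integral, so it does not change the
  -- infimum, which is therefore at most `s`.
  set w : ℕ → S := fun n => Nat.casesOn n ⟨s, hs⟩ u with hw
  have hwS (n : ℕ) : (w n : L0 P ℝ) ∈ S := (w n).2
  refine (le_of_integral_arctan_le (le_seqInf fun n => seqInf_le hS hwS (n + 1))
    (hJu.trans (csInf_le hbdd ⟨w, rfl⟩))).trans (seqInf_le hS hwS 0)

instance [IsFiniteMeasure P] : DedekindRegularRing (L0 P ℝ) where
  exists_isGLB S hne hS := by
    obtain ⟨u, -, hu⟩ := exists_isGLB_seqInf hne hS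
    exact ⟨_, hu⟩
  exists_quasiInv r hr := by
    have hr' := nonneg_iff_ae.1 hr
    refine ⟨invL0 r, ?_, ?_, ?_⟩
    · rw [nonneg_iff_ae]
      filter_upwards [hr', coeFn_invL0 r] with ω h h1
      rw [h1]
      exact inv_nonneg.2 h
    · rw [le_one_iff_ae]
      filter_upwards [coeFn_invL0 r, coeFn_mul' r (invL0 r)] with ω h1 h2
      rw [h2, h1]
      exact mul_inv_le_one
    · apply AEEqFun.ext
      filter_upwards [coeFn_invL0 r, coeFn_mul' r (invL0 r), coeFn_mul' (r * invL0 r) r]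
        with ω h1 h2 h3
      rw [h3, h2, h1]
      exact mul_inv_mul_cancel _

/-! ### From real to `K`-valued scalars -/

/-- `ofRealL0` as a ring homomorphism. -/
noncomputable def ofRealHom (P : Measure Ω) (K : Type*) [RCLike K] : L0 P ℝ →+* L0 P K where
  toFun := ofRealL0 K
  map_zero' := by
    apply AEEqFun.ext
    filter_upwards [coeFn_ofRealL0 (K := K) (0 : L0 P ℝ), coeFn_zero' (P := P) (K := K),
      coeFn_zero' (P := P) (K := ℝ)] with ω h1 h2 h3
    rw [h1, h2, h3, RCLike.ofReal_zero]
  map_one' := by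
    apply AEEqFun.ext
    filter_upwards [coeFn_ofRealL0 (K := K) (1 : L0 P ℝ), coeFn_one' (P := P) (K := K),
      coeFn_one' (P := P) (K := ℝ)] with ω h1 h2 h3
    rw [h1, h2, h3, RCLike.ofReal_one]
  map_add' a b := by
    apply AEEqFun.ext
    filter_upwards [coeFn_ofRealL0 (K := K) (a + b), coeFn_ofRealL0 (K := K) a,
      coeFn_ofRealL0 (K := K) b, coeFn_add' a b, coeFn_add' (ofRealL0 K a) (ofRealL0 K b)]
      with ω h1 h2 h3 h4 h5
    rw [h1, h5, h2, h3, h4, RCLike.ofReal_add]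
  map_mul' a b := by
    apply AEEqFun.ext
    filter_upwards [coeFn_ofRealL0 (K := K) (a * b), coeFn_ofRealL0 (K := K) a,
      coeFn_ofRealL0 (K := K) b, coeFn_mul' a b, coeFn_mul' (ofRealL0 K a) (ofRealL0 K b)]
      with ω h1 h2 h3 h4 h5
    rw [h1, h5, h2, h3, h4, RCLike.ofReal_mul]

theorem ofRealHom_apply (ξ : L0 P ℝ) : ofRealHom P K ξ = ofRealL0 K ξ := rfl

variable {X : Type*} [AddCommGroup X] [Module (L0 P K) X]

/-- The defining properties of an `L⁰`-seminorm, with absolute homogeneity as an inequality. -/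
structure IsSubseminorm (P : Measure Ω) (K : Type*) [RCLike K] {X : Type*} [AddCommGroup X]
    [Module (L0 P K) X] (p : X → L0 P ℝ) : Prop where
  nonneg : ∀ x, 0 ≤ p x
  smul_le : ∀ (ξ : L0 P K) (x : X), p (ξ • x) ≤ modulus ξ * p x
  add_le : ∀ x y, p (x + y) ≤ p x + p y

theorem modulus_ofRealL0_of_nonneg {ξ : L0 P ℝ} (h : 0 ≤ ξ) : modulus (ofRealL0 K ξ) = ξ := by
  apply AEEqFun.ext
  filter_upwards [coeFn_modulus (ofRealL0 K ξ), coeFn_ofRealL0 (K := K) ξ, nonneg_iff_ae.1 h]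
    with ω h1 h2 h3
  rw [h1, h2, RCLike.norm_ofReal, abs_of_nonneg h3]

theorem modulus_nonneg (ξ : L0 P K) : 0 ≤ modulus ξ := by
  rw [nonneg_iff_ae]
  filter_upwards [coeFn_modulus ξ] with ω h
  rw [h]
  exact norm_nonneg _

theorem modulus_zero : modulus (0 : L0 P K) = 0 := by
  apply AEEqFun.ext
  filter_upwards [coeFn_modulus (0 : L0 P K), coeFn_zero' (P := P) (K := K),
    coeFn_zero' (P := P) (K := ℝ)] with ω h1 h2 h3
  rw [h1, h2, h3, norm_zero]

theorem modulus_mul (ξ η : L0 P K) : modulus (ξ * η) = modulus ξ * modulus η := by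
  apply AEEqFun.ext
  filter_upwards [coeFn_modulus (ξ * η), coeFn_mul' ξ η, coeFn_modulus ξ, coeFn_modulus η,
    coeFn_mul' (modulus ξ) (modulus η)] with ω h1 h2 h3 h4 h5
  rw [h1, h2, h5, h3, h4, norm_mul]

theorem modulus_add_le (ξ η : L0 P K) : modulus (ξ + η) ≤ modulus ξ + modulus η := by
  rw [le_iff_ae]
  filter_upwards [coeFn_modulus (ξ + η), coeFn_add' ξ η, coeFn_modulus ξ, coeFn_modulus η,
    coeFn_add' (modulus ξ) (modulus η)] with ω h1 h2 h3 h4 h5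
  rw [h1, h2, h5, h3, h4]
  exact norm_add_le _ _

/-- Polar decomposition in `L⁰(ℱ, K)`. -/
theorem exists_modulus_mul_eq (ξ : L0 P K) :
    ∃ u : L0 P K, modulus u ≤ 1 ∧ ofRealL0 K (modulus ξ) * u = ξ := by
  refine ⟨ξ * invL0 (ofRealL0 K (modulus ξ)), ?_, ?_⟩
  · rw [modulus_le_one_iff_ae]
    filter_upwards [coeFn_mul' ξ (invL0 (ofRealL0 K (modulus ξ))),
      coeFn_invL0 (ofRealL0 K (modulus ξ)), coeFn_ofRealL0 (K := K) (modulus ξ),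
      coeFn_modulus ξ] with ω h1 h2 h3 h4
    rw [h1, h2, h3, h4, norm_mul, norm_inv, RCLike.norm_ofReal, abs_norm]
    exact mul_inv_le_one
  · apply AEEqFun.ext
    filter_upwards [coeFn_mul' (ofRealL0 K (modulus ξ)) (ξ * invL0 (ofRealL0 K (modulus ξ))),
      coeFn_mul' ξ (invL0 (ofRealL0 K (modulus ξ))),
      coeFn_invL0 (ofRealL0 K (modulus ξ)), coeFn_ofRealL0 (K := K) (modulus ξ),
      coeFn_modulus ξ] with ω h0 h1 h2 h3 h4
    rw [h0, h1, h2, h3, h4]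
    by_cases h : ξ ω = 0
    · simp [h]
    · have : ((‖ξ ω‖ : ℝ) : K) ≠ 0 := by simpa using h
      field_simp

theorem exists_mul_eq_modulus (ξ : L0 P K) :
    ∃ u : L0 P K, modulus u ≤ 1 ∧ u * ξ = ofRealL0 K (modulus ξ) := by
  refine ⟨star ξ * invL0 (ofRealL0 K (modulus ξ)), ?_, ?_⟩
  · rw [modulus_le_one_iff_ae]
    filter_upwards [coeFn_mul' (star ξ) (invL0 (ofRealL0 K (modulus ξ))), AEEqFun.coeFn_star ξ,
      coeFn_invL0 (ofRealL0 K (modulus ξ)), coeFn_ofRealL0 (K := K) (modulus ξ),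
      coeFn_modulus ξ] with ω h1 h5 h2 h3 h4
    rw [h1, h2, h3, h4, h5, norm_mul, norm_inv, RCLike.norm_ofReal, abs_norm, Pi.star_apply,
      norm_star]
    exact mul_inv_le_one
  · apply AEEqFun.ext
    filter_upwards [coeFn_mul' (star ξ * invL0 (ofRealL0 K (modulus ξ))) ξ,
      coeFn_mul' (star ξ) (invL0 (ofRealL0 K (modulus ξ))), AEEqFun.coeFn_star ξ,
      coeFn_invL0 (ofRealL0 K (modulus ξ)), coeFn_ofRealL0 (K := K) (modulus ξ),
      coeFn_modulus ξ] with ω h0 h1 h5 h2 h3 h4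
    rw [h0, h1, h2, h3, h4, h5, Pi.star_apply]
    by_cases h : ξ ω = 0
    · simp [h]
    · have h' : ((‖ξ ω‖ : ℝ) : K) ≠ 0 := by simpa using h
      have e : star (ξ ω) * ξ ω = ((‖ξ ω‖ : ℝ) : K) ^ 2 := RCLike.conj_mul (ξ ω)
      rw [mul_right_comm, e]
      field_simp

theorem ofRealL0_sub (ξ η : L0 P ℝ) : ofRealL0 K (ξ - η) = ofRealL0 K ξ - ofRealL0 K η :=
  (ofRealHom P K).map_sub ξ η

/-- The constant random variable `I`. -/
noncomputable def constI (P : Measure Ω) (K : Type*) [RCLike K] : L0 P K :=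
  AEEqFun.const Ω RCLike.I

theorem coeFn_constI : ∀ᵐ ω ∂P, constI P K ω = RCLike.I := AEEqFun.coeFn_const _ _

/-- This dichotomy lets one formula for complexification cover both `ℝ` and `ℂ`. -/
theorem constI_eq_zero_or : constI P K = 0 ∨ constI P K * constI P K = -1 := by
  rcases RCLike.I_mul_I_ax (K := K) with h | h
  · left
    rw [constI, h]
    rfl
  · right
    apply AEEqFun.ext
    filter_upwards [coeFn_mul' (constI P K) (constI P K), coeFn_constI (P := P) (K := K),
      AEEqFun.coeFn_neg (1 : L0 P K), coeFn_one' (P := P) (K := K)] with ω h1 h2 h3 h4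
    rw [h1, h2, h3, Pi.neg_apply, h4, h]

/-- The real part of a `K`-valued random variable. -/
noncomputable def reL0 (ξ : L0 P K) : L0 P ℝ :=
  AEEqFun.comp (fun z : K => RCLike.re z) RCLike.continuous_re ξ

/-- The imaginary part of a `K`-valued random variable. -/
noncomputable def imL0 (ξ : L0 P K) : L0 P ℝ :=
  AEEqFun.comp (fun z : K => RCLike.im z) RCLike.continuous_im ξ

theorem coeFn_reL0 (ξ : L0 P K) : ∀ᵐ ω ∂P, reL0 ξ ω = RCLike.re (ξ ω) :=
  AEEqFun.coeFn_comp _ _ _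

theorem coeFn_imL0 (ξ : L0 P K) : ∀ᵐ ω ∂P, imL0 ξ ω = RCLike.im (ξ ω) :=
  AEEqFun.coeFn_comp _ _ _

theorem reL0_add_imL0 (ξ : L0 P K) :
    ofRealL0 K (reL0 ξ) + ofRealL0 K (imL0 ξ) * constI P K = ξ := by
  apply AEEqFun.ext
  filter_upwards [coeFn_reL0 ξ, coeFn_imL0 ξ, coeFn_ofRealL0 (K := K) (reL0 ξ),
    coeFn_ofRealL0 (K := K) (imL0 ξ), coeFn_mul' (ofRealL0 K (imL0 ξ)) (constI P K),
    coeFn_add' (ofRealL0 K (reL0 ξ)) (ofRealL0 K (imL0 ξ) * constI P K),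
    coeFn_constI (P := P) (K := K)] with ω h1 h2 h3 h4 h5 h6 h7
  rw [h6, h5, h3, h4, h1, h2, h7, RCLike.re_add_im]

theorem reL0_sub_constI_mul (ξ η : L0 P ℝ) :
    reL0 (ofRealL0 K ξ - constI P K * ofRealL0 K η) = ξ := by
  apply AEEqFun.ext
  filter_upwards [coeFn_reL0 (ofRealL0 K ξ - constI P K * ofRealL0 K η),
    coeFn_sub' (ofRealL0 K ξ) (constI P K * ofRealL0 K η),
    coeFn_mul' (constI P K) (ofRealL0 K η), coeFn_ofRealL0 (K := K) ξ,
    coeFn_ofRealL0 (K := K) η, coeFn_constI (P := P) (K := K)] with ω h1 h2 h3 h4 h5 h6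
  rw [h1, h2, h3, h4, h5, h6]
  simp

theorem reL0_le_modulus (ξ : L0 P K) : reL0 ξ ≤ modulus ξ := by
  rw [le_iff_ae]
  filter_upwards [coeFn_reL0 ξ, coeFn_modulus ξ] with ω h1 h2
  rw [h1, h2]
  exact RCLike.re_le_norm _

theorem reL0_ofRealL0 (ξ : L0 P ℝ) : reL0 (ofRealL0 K ξ) = ξ := by
  simpa [← ofRealHom_apply] using reL0_sub_constI_mul (K := K) ξ 0

/-- A real-linear map to `L⁰(ℱ)` is the real part of a linear map to `L⁰(ℱ, K)`. -/
theorem exists_linearMap_reL0_eq (g : X → L0 P ℝ) (hadd : ∀ x y, g (x + y) = g x + g y)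
    (hsmul : ∀ (r : L0 P ℝ) x, g (ofRealL0 K r • x) = r * g x) :
    ∃ f : X →ₗ[L0 P K] L0 P K, ∀ x, reL0 (f x) = g x := by
  -- The classical `g x - i g (i x)`; the second term disappears when `I = 0`.
  set F : X → L0 P K := fun x => ofRealHom P K (g x) - constI P K * ofRealHom P K (g (constI P K • x))
    with hF
  have Fadd (x y : X) : F (x + y) = F x + F y := by
    simp only [hF, smul_add, hadd, map_add]
    ring
  have Freal (r : L0 P ℝ) (x : X) : F (ofRealL0 K r • x) = ofRealL0 K r * F x := by
    simp only [hF, hsmul, smul_comm (constI P K) (ofRealL0 K r) x, map_mul]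
    rw [ofRealHom_apply r]
    ring
  have gneg (x : X) : g (-x) = -g x := by
    have h0 : g 0 = 0 := by simpa using hadd 0 0
    rw [eq_neg_iff_add_eq_zero, ← hadd, neg_add_cancel, h0]
  have g0 : g 0 = 0 := by simpa using hadd 0 0
  have FI (x : X) : F (constI P K • x) = constI P K * F x := by
    rcases constI_eq_zero_or (P := P) (K := K) with h | h
    · simp [hF, h, g0]
    · simp only [hF, smul_smul, h, neg_smul, one_smul, gneg, map_neg]
      linear_combination (ofRealHom P K (g (constI P K • x))) * h
  refine ⟨{ toFun := F, map_add' := Fadd, map_smul' := fun ξ x => ?_ },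
    fun x => reL0_sub_constI_mul _ _⟩
  rw [← reL0_add_imL0 ξ, add_smul, Fadd, mul_smul, Freal, Freal, FI, RingHom.id_apply, smul_eq_mul]
  ring

/-- The Hahn–Banach theorem for `L⁰(ℱ, K)`-modules. -/
theorem IsSubseminorm.exists_linearMap_modulus_le [IsFiniteMeasure P] {p : X → L0 P ℝ}
    (hp : IsSubseminorm P K p) (z : X) :
    ∃ f : X →ₗ[L0 P K] L0 P K, (∀ x, modulus (f x) ≤ p x) ∧ p z ≤ modulus (f z) := by
  let _ : Module (L0 P ℝ) X := Module.compHom X (ofRealHom P K)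
  have hsub : IsSublinear p := ⟨hp.add_le, fun r x hr => by
    have := hp.smul_le (ofRealL0 K r) x
    rwa [modulus_ofRealL0_of_nonneg hr] at this⟩
  obtain ⟨g, hgp, hgz⟩ := hsub.exists_linearMap_le z
  obtain ⟨f, hf⟩ := exists_linearMap_reL0_eq (K := K) g (map_add g) fun r x => map_smul g r x
  refine ⟨f, fun x => ?_, ?_⟩
  -- Rotate by the phase: `u * f x = |f x|` is real, so `|f x| = g (u • x) ≤ p (u • x) ≤ p x`.
  · obtain ⟨u, hu, h⟩ := exists_mul_eq_modulus (f x)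
    have e : g (u • x) = modulus (f x) := by
      rw [← hf, map_smul, smul_eq_mul, h, reL0_ofRealL0]
    rw [← e]
    refine (hgp _).trans ((hp.smul_le u x).trans ?_)
    exact mul_le_of_le_one_left (hp.nonneg x) hu
  · rw [← hgz, ← hf]
    exact reL0_le_modulus _

theorem ofRealL0_mul (ξ η : L0 P ℝ) : ofRealL0 K (ξ * η) = ofRealL0 K ξ * ofRealL0 K η :=
  (ofRealHom P K).map_mul ξ η

theorem ofRealL0_one : ofRealL0 K (1 : L0 P ℝ) = 1 := (ofRealHom P K).map_one

theorem ofRealL0_zero : ofRealL0 K (0 : L0 P ℝ) = 0 := (ofRealHom P K).map_zero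

theorem IsSubseminorm.map_zero {p : X → L0 P ℝ} (hp : IsSubseminorm P K p) : p 0 = 0 := by
  refine le_antisymm ?_ (hp.nonneg 0)
  simpa [modulus_zero] using hp.smul_le 0 0

/-- Subseminorms are local: they take the same values at elements which agree on `A`. -/
theorem IsSubseminorm.ae_le_of_ind_smul_eq {p : X → L0 P ℝ} (hp : IsSubseminorm P K p)
    {A : Set Ω} (hA : MeasurableSet A) {x y : X} (h : ind P K A hA • x = ind P K A hA • y) :
    ∀ᵐ ω ∂P, ω ∈ A → p x ω ≤ p y ω := by
  set i := ind P K A hA with hi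
  -- On `A` the two coefficients are `1` and `0`, so there only `p y` survives.
  have e : x = i • y + (1 - i) • x := by rw [← h, sub_smul, one_smul, add_sub_cancel]
  have h1 : p x ≤ modulus i * p y + modulus (1 - i) * p x := by
    conv_lhs => rw [e]
    exact (hp.add_le _ _).trans (add_le_add (hp.smul_le _ _) (hp.smul_le _ _))
  filter_upwards [le_iff_ae.1 h1, coeFn_add' (modulus i * p y) (modulus (1 - i) * p x),
    coeFn_mul' (modulus i) (p y), coeFn_mul' (modulus (1 - i)) (p x), coeFn_modulus i,
    coeFn_modulus (1 - i), coeFn_sub' 1 i, coeFn_one' (P := P) (K := K),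
    coeFn_ind (P := P) (K := K) A hA] with ω h1 h2 h3 h4 h5 h6 h7 h8 h9 hω
  rw [h2, h3, h4, h5, h6, h7, h8, hi, h9, Set.indicator_of_mem hω] at h1
  simpa using h1

/-- A set is stable under countable concatenation. -/
def IsConcatenationStable (P : Measure Ω) (K : Type*) [RCLike K] {X : Type*} [AddCommGroup X]
    [Module (L0 P K) X] (G : Set X) : Prop :=
  ∀ (A : CountablePartition Ω) (u : ℕ → X) (x : X), (∀ n, u n ∈ G) → IsConcatenation P K A u x →
    x ∈ G

/-- Make the `B n` disjoint. The null set they miss is first adjoined to each of them, so that the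
parts cover `Ω` everywhere; hence the inclusions hold only almost surely. -/
theorem exists_countablePartition {B : ℕ → Set Ω} (hB : ∀ n, MeasurableSet (B n))
    (hcov : ∀ᵐ ω ∂P, ∃ n, ω ∈ B n) :
    ∃ A : CountablePartition Ω, ∀ n, ∀ᵐ ω ∂P, ω ∈ A.part n → ω ∈ B n := by
  set B' : ℕ → Set Ω := fun n => B n ∪ (⋃ m, B m)ᶜ with hB'
  refine ⟨⟨disjointed B', fun n => MeasurableSet.disjointed
    (fun m => (hB m).union (MeasurableSet.iUnion hB).compl) n, disjoint_disjointed B', ?_⟩,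
    fun n => ?_⟩
  · rw [iUnion_disjointed, Set.eq_univ_iff_forall]
    intro ω
    by_cases h : ω ∈ ⋃ m, B m
    · obtain ⟨n, hn⟩ := Set.mem_iUnion.1 h
      exact Set.mem_iUnion.2 ⟨n, Or.inl hn⟩
    · exact Set.mem_iUnion.2 ⟨0, Or.inr h⟩
  · filter_upwards [hcov] with ω hω hn
    rcases disjointed_subset B' n hn with h | h
    · exact h
    · exact absurd (Set.mem_iUnion.2 hω) h

/-! ### The regularised gauge and separation -/

/-- The values whose essential infimum is the infimal convolution of the gauge of `G` with
`C * N`. -/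
def gaugeValues (G : Set X) (C : L0 P ℝ) (N : X → L0 P ℝ) (K : Type*) [RCLike K]
    [Module (L0 P K) X] (z : X) : Set (L0 P ℝ) :=
  {a | ∃ l : L0 P ℝ, 0 ≤ l ∧ ∃ g ∈ G, a = l + C * N (z - ofRealL0 K l • g)}

/-- Take `t = l / (l + m)`, read as `0` where both vanish. Then `l g + m h = (l + m) (t g + (1 - t)
h)`, which makes the gauge subadditive on a convex `G`. -/
theorem exists_mul_eq_of_nonneg {l m : L0 P ℝ} (hl : 0 ≤ l) (hm : 0 ≤ m) :
    ∃ t : L0 P ℝ, 0 ≤ t ∧ t ≤ 1 ∧ (l + m) * t = l := by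
  refine ⟨l * invL0 (l + m), ?_, ?_, ?_⟩
  · rw [nonneg_iff_ae]
    filter_upwards [nonneg_iff_ae.1 hl, nonneg_iff_ae.1 hm, coeFn_mul' l (invL0 (l + m)),
      coeFn_invL0 (l + m), coeFn_add' l m] with ω h1 h2 h3 h4 h5
    rw [h3, h4, h5]
    positivity
  · rw [le_one_iff_ae]
    filter_upwards [nonneg_iff_ae.1 hl, nonneg_iff_ae.1 hm, coeFn_mul' l (invL0 (l + m)),
      coeFn_invL0 (l + m), coeFn_add' l m] with ω h1 h2 h3 h4 h5
    rw [h3, h4, h5]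
    exact div_le_one_of_le₀ (by linarith) (by linarith)
  · apply AEEqFun.ext
    filter_upwards [nonneg_iff_ae.1 hl, nonneg_iff_ae.1 hm, coeFn_mul' l (invL0 (l + m)),
      coeFn_mul' (l + m) (l * invL0 (l + m)),
      coeFn_invL0 (l + m), coeFn_add' l m] with ω h1 h2 h3 h6 h4 h5
    rw [h6, h3, h4, h5]
    rcases (add_nonneg h1 h2).eq_or_lt' with h | h
    · have : l ω = 0 := by linarith
      rw [this]
      simp
    · field_simp

section Gauge

variable {G : Set X} {C : L0 P ℝ} {N : X → L0 P ℝ}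

theorem gaugeValues_nonempty (hG : G.Nonempty) (z : X) : (gaugeValues G C N K z).Nonempty :=
  ⟨_, 0, le_rfl, hG.some, hG.some_mem, rfl⟩

theorem gaugeValues_nonneg (hN : IsSubseminorm P K N) (hC : 0 ≤ C) (z : X) :
    0 ∈ lowerBounds (gaugeValues G C N K z) := by
  rintro _ ⟨l, hl, g, -, rfl⟩
  exact add_nonneg hl (mul_nonneg hC (hN.nonneg _))

theorem exists_mem_gaugeValues_add_le (hconv : IsL0Convex P K G)
    (hN : IsSubseminorm P K N) (hC : 0 ≤ C) {x y : X} {a c : L0 P ℝ}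
    (ha : a ∈ gaugeValues G C N K x) (hc : c ∈ gaugeValues G C N K y) :
    ∃ d ∈ gaugeValues G C N K (x + y), d ≤ a + c := by
  obtain ⟨l, hl, g, hg, rfl⟩ := ha
  obtain ⟨m, hm, h, hh, rfl⟩ := hc
  obtain ⟨t, ht0, ht1, ht⟩ := exists_mul_eq_of_nonneg hl hm
  refine ⟨_, ⟨l + m, add_nonneg hl hm, _, hconv g hg h hh t ht0 ht1, rfl⟩, ?_⟩
  have hm' : (l + m) * (1 - t) = m := by rw [mul_sub, ht, mul_one, add_sub_cancel_left]
  have e : x + y - ofRealL0 K (l + m) • (ofRealL0 K t • g + (1 - ofRealL0 K t) • h) =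
      (x - ofRealL0 K l • g) + (y - ofRealL0 K m • h) := by
    rw [smul_add, smul_smul, smul_smul, ← ofRealL0_one, ← ofRealL0_sub, ← ofRealL0_mul,
      ← ofRealL0_mul, ht, hm']
    abel
  rw [e]
  calc l + m + C * N (x - ofRealL0 K l • g + (y - ofRealL0 K m • h))
      ≤ l + m + C * (N (x - ofRealL0 K l • g) + N (y - ofRealL0 K m • h)) :=
        add_le_add_right (mul_le_mul_of_nonneg_left (hN.add_le _ _) hC) _
    _ = _ := by ring

theorem exists_mem_gaugeValues_smul_le (hbal : IsL0Balanced P K G)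
    (hN : IsSubseminorm P K N) (hC : 0 ≤ C) (ξ : L0 P K) {x : X} {a : L0 P ℝ}
    (ha : a ∈ gaugeValues G C N K x) :
    ∃ d ∈ gaugeValues G C N K (ξ • x), d ≤ modulus ξ * a := by
  obtain ⟨l, hl, g, hg, rfl⟩ := ha
  obtain ⟨u, hu, h⟩ := exists_modulus_mul_eq ξ
  refine ⟨_, ⟨modulus ξ * l, mul_nonneg (modulus_nonneg ξ) hl, _, hbal u hu g hg, rfl⟩, ?_⟩
  have e : ξ • x - ofRealL0 K (modulus ξ * l) • u • g = ξ • (x - ofRealL0 K l • g) := by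
    rw [smul_sub, smul_smul, smul_smul, ofRealL0_mul, mul_right_comm, h]
  rw [e]
  calc modulus ξ * l + C * N (ξ • (x - ofRealL0 K l • g))
      ≤ modulus ξ * l + C * (modulus ξ * N (x - ofRealL0 K l • g)) :=
        add_le_add_right (mul_le_mul_of_nonneg_left (hN.smul_le _ _) hC) _
    _ = _ := by ring

theorem isSubseminorm_of_isGLB_gaugeValues [IsFiniteMeasure P] (hne : G.Nonempty)
    (hbal : IsL0Balanced P K G)
    (hconv : IsL0Convex P K G) (hN : IsSubseminorm P K N) (hC : 0 ≤ C) {p : X → L0 P ℝ}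
    (hp : ∀ z, IsGLB (gaugeValues G C N K z) (p z)) : IsSubseminorm P K p where
  nonneg z := (hp z).2 (gaugeValues_nonneg hN hC z)
  smul_le ξ z := by
    refine (hp z).le_mul_of_nonneg (gaugeValues_nonempty hne z) (modulus_nonneg ξ) fun a ha => ?_
    obtain ⟨d, hd, hle⟩ := exists_mem_gaugeValues_smul_le hbal hN hC ξ ha
    exact ((hp _).1 hd).trans hle
  add_le x y := by
    rw [← sub_le_iff_le_add]
    refine (hp x).2 fun a ha => ?_
    rw [sub_le_comm]
    refine (hp y).2 fun c hc => ?_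
    rw [sub_le_iff_le_add']
    obtain ⟨d, hd, hle⟩ := exists_mem_gaugeValues_add_le hconv hN hC ha hc
    exact ((hp _).1 hd).trans hle

/-- The tolerance is `δ = ε / (2 n + 2)`, small enough that an error `δ * n` uses at most half of
`ε`. -/
theorem ae_pos_and_mul_le {ε δ n : L0 P ℝ} (hε : IsStrictlyPos ε) (hN : 0 ≤ n)
    (hδ : δ = ε * invL0 (n + n + 1 + 1)) : ∀ᵐ ω ∂P, 0 < δ ω ∧ δ ω * n ω ≤ ε ω / 2 := by
  filter_upwards [hε, nonneg_iff_ae.1 (hN), coeFn_mul' ε (invL0 (n + n + 1 + 1)),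
    coeFn_invL0 (n + n + 1 + 1), coeFn_add' (n + n + 1) 1, coeFn_add' (n + n) 1,
    coeFn_add' n n, coeFn_one' (P := P) (K := ℝ)] with ω h1 h2 h3 h4 h5 h6 h7 h8
  rw [hδ, h3, h4, h5, h6, h7, h8]
  refine ⟨by positivity, ?_⟩
  rw [← div_eq_mul_inv, div_mul_eq_mul_div, div_le_div_iff₀ (by positivity) (by positivity)]
  nlinarith

/-- A near-optimal value of the gauge at `x` yields, on the set `B` where it is near-optimal, a
point of `G` near `x`. -/
theorem exists_mem_ae_sub_le (hbal : IsL0Balanced P K G) (hN : IsSubseminorm P K N)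
    {x : X} {ε δ a : L0 P ℝ} (hε : IsStrictlyPos ε) (hδ : δ = ε * invL0 (N x + N x + 1 + 1))
    (ha : a ∈ gaugeValues G (invL0 ε + invL0 ε) N K x) :
    ∃ g ∈ G, ∀ᵐ ω ∂P, a ω < 1 + δ ω → N (x - g) ω ≤ ε ω := by
  obtain ⟨l, hl, g, hg, rfl⟩ := ha
  set C := invL0 ε + invL0 ε with hC
  -- Where `a < 1 + δ` one has `l ≤ 1 + δ`, so `l * k ≤ 1` and the truncation is inactive; elsewhere
  -- it keeps `η ≤ 1`, so that `η g ∈ G`.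
  set k := invL0 (1 + δ) with hk
  set η := (l * k) ⊓ 1 with hη
  have hδpos := ae_pos_and_mul_le hε (hN.nonneg x) hδ
  have hkω : ∀ᵐ ω ∂P, k ω = (1 + δ ω)⁻¹ := by
    filter_upwards [coeFn_invL0 (1 + δ), coeFn_add' 1 δ, coeFn_one' (P := P) (K := ℝ)]
      with ω h1 h2 h3
    rw [hk, h1, h2, h3]
  have hηω : ∀ᵐ ω ∂P, η ω = (l ω * k ω) ⊓ 1 := by
    filter_upwards [AEEqFun.coeFn_inf (l * k) 1, coeFn_mul' l k, coeFn_one' (P := P) (K := ℝ)]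
      with ω h1 h2 h3
    rw [hη, h1, h2, h3]
  have hη0 : 0 ≤ η := by
    rw [nonneg_iff_ae]
    filter_upwards [hηω, hkω, hδpos, nonneg_iff_ae.1 hl] with ω h1 h2 h3 h4
    have := h3.1
    rw [h1, h2]
    exact le_inf (by positivity) zero_le_one
  refine ⟨ofRealL0 K η • g, hbal _ ?_ g hg, ?_⟩
  · rw [modulus_ofRealL0_of_nonneg hη0]
    exact inf_le_right
  -- On the good set the last term vanishes. The first costs at most `δ * N x ≤ ε / 2`, and the
  -- middle one at most `ε / 2` because `(2 / ε) * N (x - l g) ≤ 1 + δ`.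
  have e : x - ofRealL0 K η • g = ofRealL0 K (1 - k) • x +
      (ofRealL0 K k • (x - ofRealL0 K l • g) + ofRealL0 K (k * l - η) • g) := by
    rw [smul_sub, smul_smul, ofRealL0_sub, ofRealL0_sub, sub_smul, sub_smul, ofRealL0_mul,
      ofRealL0_one, one_smul]
    abel
  have hle : N (x - ofRealL0 K η • g) ≤ modulus (ofRealL0 K (1 - k)) * N x +
      (modulus (ofRealL0 K k) * N (x - ofRealL0 K l • g) +
        modulus (ofRealL0 K (k * l - η)) * N g) := by
    rw [e]
    refine (hN.add_le _ _).trans (add_le_add (hN.smul_le _ _) ((hN.add_le _ _).trans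
      (add_le_add (hN.smul_le _ _) (hN.smul_le _ _))))
  have hmod (r : L0 P ℝ) : ∀ᵐ ω ∂P, modulus (ofRealL0 K r) ω = |r ω| := by
    filter_upwards [coeFn_modulus (ofRealL0 K r), coeFn_ofRealL0 (K := K) r] with ω h1 h2
    rw [h1, h2, RCLike.norm_ofReal]
  have hbound : ∀ᵐ ω ∂P, N (x - ofRealL0 K η • g) ω ≤ |1 - k ω| * N x ω +
      (|k ω| * N (x - ofRealL0 K l • g) ω + |k ω * l ω - η ω| * N g ω) := by
    filter_upwards [le_iff_ae.1 hle, hmod (1 - k), hmod k, hmod (k * l - η),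
      coeFn_add' (modulus (ofRealL0 K (1 - k)) * N x)
        (modulus (ofRealL0 K k) * N (x - ofRealL0 K l • g) +
        modulus (ofRealL0 K (k * l - η)) * N g),
      coeFn_add' (modulus (ofRealL0 K k) * N (x - ofRealL0 K l • g))
        (modulus (ofRealL0 K (k * l - η)) * N g),
      coeFn_mul' (modulus (ofRealL0 K (1 - k))) (N x),
      coeFn_mul' (modulus (ofRealL0 K k)) (N (x - ofRealL0 K l • g)),
      coeFn_mul' (modulus (ofRealL0 K (k * l - η))) (N g), coeFn_sub' 1 k,
      coeFn_sub' (k * l) η, coeFn_mul' k l, coeFn_one' (P := P) (K := ℝ)]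
      with ω h h1 h2 h3 h4 h5 h6 h7 h8 h9 h10 h11 h12
    rwa [h4, h5, h6, h7, h8, h1, h2, h3, h9, h10, h11, h12] at h
  filter_upwards [hbound, hkω, hηω, hδpos, hε, nonneg_iff_ae.1 hl,
    nonneg_iff_ae.1 (hN.nonneg x), nonneg_iff_ae.1 (hN.nonneg (x - ofRealL0 K l • g)),
    coeFn_add' l (C * N (x - ofRealL0 K l • g)), coeFn_mul' C (N (x - ofRealL0 K l • g)),
    coeFn_add' (invL0 ε) (invL0 ε), coeFn_invL0 ε] with ω h h1 h2 h3 h4 h5 h6 h7 h8 h9 h10 h11 ha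
  rw [h8, h9, hC, h10, h11] at ha
  obtain ⟨hd, hdx⟩ := h3
  set n := N (x - ofRealL0 K l • g) ω with hn
  have hprod : 0 ≤ ((ε ω)⁻¹ + (ε ω)⁻¹) * n := by positivity
  have hl1 : l ω ≤ 1 + δ ω := by linarith
  have hn1 : n ≤ (1 + δ ω) * (ε ω / 2) := by
    have : ((ε ω)⁻¹ + (ε ω)⁻¹) * n ≤ 1 + δ ω := by linarith
    have h' := mul_le_mul_of_nonneg_right this (by positivity : 0 ≤ ε ω / 2)
    have e' : ((ε ω)⁻¹ + (ε ω)⁻¹) * n * (ε ω / 2) = n := by field_simp; ring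
    rwa [e'] at h'
  have hη' : η ω = k ω * l ω := by
    rw [h2, inf_eq_left.2, mul_comm]
    rw [h1, ← div_eq_mul_inv]
    exact (div_le_one (by positivity)).2 hl1
  have hk0 : 0 ≤ k ω := by rw [h1]; positivity
  have hk1 : 1 - k ω = k ω * δ ω := by rw [h1]; field_simp; ring
  have hk2 : k ω ≤ 1 := by rw [h1]; exact inv_le_one_of_one_le₀ (by linarith)
  have hkd : k ω * (1 + δ ω) = 1 := by rw [h1]; field_simp
  rw [hη', sub_self, abs_zero, zero_mul, add_zero, abs_of_nonneg hk0, hk1,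
    abs_of_nonneg (by positivity)] at h
  have hA : k ω * n ≤ ε ω / 2 := by
    have := mul_le_mul_of_nonneg_left hn1 hk0
    rwa [← mul_assoc, hkd, one_mul] at this
  have hB : k ω * δ ω * N x ω ≤ ε ω / 2 := by
    rw [mul_assoc]
    exact (mul_le_of_le_one_left (by positivity) hk2).trans hdx
  linarith

/-- If the gauge is at most one at `x` then `G` comes within `ε` of `x`. -/
theorem exists_mem_sub_le_of_isGLB [IsFiniteMeasure P] (hX : HasCountableConcatenation P K X)
    (hne : G.Nonempty) (hstab : IsConcatenationStable P K G)
    (hbal : IsL0Balanced P K G) (hN : IsSubseminorm P K N) {ε : L0 P ℝ} (hε : IsStrictlyPos ε)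
    (hC : 0 ≤ invL0 ε + invL0 ε) {x : X} {c : L0 P ℝ}
    (hc : IsGLB (gaugeValues G (invL0 ε + invL0 ε) N K x) c) (hc1 : c ≤ 1) :
    ∃ g ∈ G, N (x - g) ≤ ε := by
  obtain ⟨u, hu, huc⟩ := exists_isGLB_seqInf (gaugeValues_nonempty hne x)
    ⟨0, gaugeValues_nonneg (K := K) (G := G) hN hC x⟩
  have hcu : c = seqInf u := hc.unique huc
  set δ : L0 P ℝ := ε * invL0 (N x + N x + 1 + 1) with hδ
  choose g hg hgu using fun n => exists_mem_ae_sub_le hbal hN hε hδ (hu n)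
  have hcov : ∀ᵐ ω ∂P, ∃ n, ω ∈ {ω | u n ω < 1 + δ ω} := by
    filter_upwards [le_one_iff_ae.1 hc1, coeFn_seqInf u, ae_pos_and_mul_le hε (hN.nonneg x) hδ]
      with ω h1 h2 h3
    rw [hcu, h2] at h1
    exact exists_lt_of_ciInf_lt (h1.trans_lt (lt_add_of_pos_right 1 h3.1))
  obtain ⟨A, hA⟩ := exists_countablePartition
    (fun n => measurableSet_lt (u n).measurable (δ.measurable.const_add 1)) hcov
  obtain ⟨g', hg'⟩ := hX A g
  refine ⟨g', hstab A g g' hg hg', ?_⟩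
  have hloc (n : ℕ) : ∀ᵐ ω ∂P, ω ∈ A.part n → N (x - g') ω ≤ N (x - g n) ω :=
    hN.ae_le_of_ind_smul_eq (A.measurable n) (by rw [smul_sub, smul_sub, hg' n])
  rw [le_iff_ae]
  filter_upwards [ae_all_iff.2 hA, ae_all_iff.2 hloc, ae_all_iff.2 hgu] with ω h1 h2 h3
  obtain ⟨n, hn⟩ := Set.mem_iUnion.1 (A.iUnion_eq ▸ Set.mem_univ ω)
  exact (h2 n hn).trans (h3 n (h1 n hn))

/-- Separation of a point from a balanced, convex and concatenation stable set. -/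
theorem exists_linearMap_separating [IsFiniteMeasure P] (hX : HasCountableConcatenation P K X)
    (hne : G.Nonempty) (hstab : IsConcatenationStable P K G)
    (hbal : IsL0Balanced P K G) (hconv : IsL0Convex P K G) (hN : IsSubseminorm P K N)
    {ε : L0 P ℝ} (hε : IsStrictlyPos ε) {x : X} (hx : ∀ g ∈ G, ¬ N (x - g) ≤ ε) :
    ∃ f : X →ₗ[L0 P K] L0 P K, (∀ z, modulus (f z) ≤ (invL0 ε + invL0 ε) * N z) ∧
      (∀ g ∈ G, modulus (f g) ≤ 1) ∧ ¬ modulus (f x) ≤ 1 := by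
  have hC : 0 ≤ invL0 ε + invL0 ε := by
    have : 0 ≤ invL0 ε := by
      rw [nonneg_iff_ae]
      filter_upwards [hε, coeFn_invL0 ε] with ω h1 h2
      rw [h2]
      positivity
    exact add_nonneg this this
  choose p hp using fun z : X => DedekindRegularRing.exists_isGLB
    (gaugeValues G (invL0 ε + invL0 ε) N K z) (gaugeValues_nonempty hne z)
    ⟨0, gaugeValues_nonneg hN hC z⟩
  obtain ⟨f, hfp, hfx⟩ :=
    (isSubseminorm_of_isGLB_gaugeValues hne hbal hconv hN hC hp).exists_linearMap_modulus_le x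
  refine ⟨f, fun z => (hfp z).trans ((hp z).1 ?_), fun g hg => (hfp g).trans ((hp g).1 ?_),
    fun h => ?_⟩
  -- The values at `l = 0`, and at `l = 1` with `g` itself, give the two bounds on `f`.
  · exact ⟨0, le_rfl, hne.some, hne.some_mem, by rw [ofRealL0_zero, zero_smul, sub_zero, zero_add]⟩
  · exact ⟨1, zero_le_one, g, hg, by
      rw [ofRealL0_one, one_smul, sub_self, hN.map_zero, mul_zero, add_zero]⟩
  · obtain ⟨g, hg, hle⟩ :=
      exists_mem_sub_le_of_isGLB hX hne hstab hbal hN hε hC (hp x) (hfx.trans h)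
    exact hx g hg hle

end Gauge

/-! ### Stability properties of the hulls -/

section Hulls

theorem ind_inter {A B : Set Ω} (hA : MeasurableSet A) (hB : MeasurableSet B) :
    ind P K (A ∩ B) (hA.inter hB) = ind P K A hA * ind P K B hB := by
  apply AEEqFun.ext
  filter_upwards [coeFn_ind (P := P) (K := K) A hA, coeFn_ind (P := P) (K := K) B hB,
    coeFn_ind (P := P) (K := K) (A ∩ B) (hA.inter hB),
    coeFn_mul' (ind P K A hA) (ind P K B hB)] with ω h1 h2 h3 h4
  rw [h3, h4, h1, h2]
  by_cases hA : ω ∈ A <;> by_cases hB : ω ∈ B <;> simp [hA, hB]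

/-- The common refinement of a countable partition and countable partitions of its parts. -/
def CountablePartition.refine (A : CountablePartition Ω) (B : ℕ → CountablePartition Ω) :
    CountablePartition Ω where
  part k := A.part k.unpair.1 ∩ (B k.unpair.1).part k.unpair.2
  measurable k := (A.measurable _).inter ((B _).measurable _)
  disjoint j k hjk := by
    refine Set.disjoint_left.2 ?_
    rintro ω ⟨h1, h2⟩ ⟨h3, h4⟩
    have e1 : j.unpair.1 = k.unpair.1 := by
      by_contra h
      exact Set.disjoint_left.1 (A.disjoint h) h1 h3
    have e2 : j.unpair.2 = k.unpair.2 := by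
      by_contra h
      rw [e1] at h2
      exact Set.disjoint_left.1 ((B _).disjoint h) h2 h4
    exact hjk (by rw [← Nat.pair_unpair j, ← Nat.pair_unpair k, e1, e2])
  iUnion_eq := by
    rw [Set.eq_univ_iff_forall]
    intro ω
    obtain ⟨n, hn⟩ := Set.mem_iUnion.1 (A.iUnion_eq ▸ Set.mem_univ ω)
    obtain ⟨m, hm⟩ := Set.mem_iUnion.1 ((B n).iUnion_eq ▸ Set.mem_univ ω)
    exact Set.mem_iUnion.2 ⟨Nat.pair n m, by simpa using ⟨hn, hm⟩⟩

/-- A concatenation of concatenations is one concatenation along the common refinement. -/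
theorem isConcatenationStable_ccHull (G : Set X) : IsConcatenationStable P K (ccHull P K G) := by
  intro A u x hu hx
  choose B v hv huv using hu
  refine ⟨A.refine B, fun k => v k.unpair.1 k.unpair.2, fun k => hv _ _, fun k => ?_⟩
  have h1 := hx k.unpair.1
  have h2 := huv k.unpair.1 k.unpair.2
  have e := ind_inter (P := P) (K := K) (A.measurable k.unpair.1)
    ((B k.unpair.1).measurable k.unpair.2)
  change ind P K (A.part k.unpair.1 ∩ (B k.unpair.1).part k.unpair.2) _ • x =
    ind P K (A.part k.unpair.1 ∩ (B k.unpair.1).part k.unpair.2) _ • _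
  rw [e, mul_smul, mul_smul, ← h2, smul_comm, h1, smul_comm]

theorem subset_ccHull (G : Set X) : G ⊆ ccHull P K G := fun x hx =>
  ⟨⟨disjointed fun _ => Set.univ, MeasurableSet.disjointed fun _ => MeasurableSet.univ,
    disjoint_disjointed _, by rw [iUnion_disjointed, Set.iUnion_const]⟩,
    fun _ => x, fun _ => hx, fun _ => rfl⟩

theorem isL0Balanced_ccHull {G : Set X} (hG : IsL0Balanced P K G) :
    IsL0Balanced P K (ccHull P K G) := by
  rintro η hη x ⟨A, u, hu, hx⟩
  exact ⟨A, fun n => η • u n, fun n => hG η hη _ (hu n), fun n => by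
    rw [smul_comm, hx n, smul_comm]⟩

theorem isL0Convex_ccHull {G : Set X} (hG : IsL0Convex P K G) :
    IsL0Convex P K (ccHull P K G) := by
  -- One variable at a time: with `y ∈ G` fixed, a single partition suffices; a general `y` then
  -- follows from stability of the hull.
  have hmix {x : X} (hx : x ∈ ccHull P K G) {y : X} (hy : y ∈ G) (ξ : L0 P ℝ) (h0 : 0 ≤ ξ)
      (h1 : ξ ≤ 1) : ofRealL0 K ξ • x + (1 - ofRealL0 K ξ) • y ∈ ccHull P K G := by
    obtain ⟨A, u, hu, hx⟩ := hx
    refine ⟨A, fun n => ofRealL0 K ξ • u n + (1 - ofRealL0 K ξ) • y,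
      fun n => hG _ (hu n) _ hy ξ h0 h1, fun n => ?_⟩
    rw [smul_add, smul_add, smul_comm, hx n, smul_comm]
  rintro x hx y ⟨B, v, hv, hy⟩ ξ h0 h1
  refine isConcatenationStable_ccHull G B
    (fun n => ofRealL0 K ξ • x + (1 - ofRealL0 K ξ) • v n) _ (fun n => hmix hx (hv n) ξ h0 h1)
    fun n => ?_
  rw [smul_add, smul_add, smul_comm _ (1 - ofRealL0 K ξ) y, hy n,
    smul_comm _ (1 - ofRealL0 K ξ) (v n)]

theorem isL0Balanced_balancedConvexHull (A : Set X) :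
    IsL0Balanced P K (balancedConvexHull P K A) :=
  fun η hη x hx B hB => hB.2.1 η hη x (hx B hB)

theorem isL0Convex_balancedConvexHull (A : Set X) :
    IsL0Convex P K (balancedConvexHull P K A) :=
  fun x hx y hy ξ h0 h1 B hB => hB.2.2 x (hx B hB) y (hy B hB) ξ h0 h1

theorem subset_balancedConvexHull (A : Set X) : A ⊆ balancedConvexHull P K A :=
  fun _ hx _ hB => hB.1 hx

end Hulls

/-! ### Seminorms, continuity and closedness -/

section Seminorms

/-- Nonnegativity of `c` is needed because the supremum over the empty set is `0`. -/
theorem finSup_le_iff {Q : Finset (L0Seminorm P K X)} {x : X} {c : L0 P ℝ} (hc : 0 ≤ c) :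
    finSup Q x ≤ c ↔ ∀ p ∈ Q, p.toFun x ≤ c := by
  change (Q.sup fun p => (⟨p.toFun x, p.nonneg x⟩ : Set.Ici (0 : L0 P ℝ))) ≤ ⟨c, hc⟩ ↔ _
  rw [Finset.sup_le_iff]
  rfl

theorem finSup_nonneg (Q : Finset (L0Seminorm P K X)) (x : X) : 0 ≤ finSup Q x :=
  (Q.sup fun p => (⟨p.toFun x, p.nonneg x⟩ : Set.Ici (0 : L0 P ℝ))).2

theorem le_finSup {Q : Finset (L0Seminorm P K X)} {p : L0Seminorm P K X} (hp : p ∈ Q) (x : X) :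
    p.toFun x ≤ finSup Q x :=
  (finSup_le_iff (finSup_nonneg Q x)).1 le_rfl p hp

theorem isSubseminorm_finSup (Q : Finset (L0Seminorm P K X)) :
    IsSubseminorm P K (finSup Q) where
  nonneg := finSup_nonneg Q
  smul_le ξ x := by
    refine (finSup_le_iff (mul_nonneg (modulus_nonneg ξ) (finSup_nonneg Q x))).2 fun p hp => ?_
    rw [p.smul]
    exact mul_le_mul_of_nonneg_left (le_finSup hp x) (modulus_nonneg ξ)
  add_le x y := by
    refine (finSup_le_iff (add_nonneg (finSup_nonneg Q x) (finSup_nonneg Q y))).2 fun p hp => ?_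
    exact (p.add_le x y).trans (add_le_add (le_finSup hp x) (le_finSup hp y))

theorem isSubseminorm_modulus_comp (f : X →ₗ[L0 P K] L0 P K) :
    IsSubseminorm P K fun x => modulus (f x) where
  nonneg x := modulus_nonneg _
  smul_le ξ x := by rw [map_smul, smul_eq_mul, modulus_mul]
  add_le x y := by rw [map_add]; exact modulus_add_le _ _

/-- A homomorphism dominated by a multiple of a finite supremum of seminorms is continuous. -/
theorem mem_conjugateSpace_of_modulus_le {S : Set (L0Seminorm P K X)}
    {Q : Finset (L0Seminorm P K X)} (hQ : (Q : Set (L0Seminorm P K X)) ⊆ S)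
    {f : X →ₗ[L0 P K] L0 P K} {C : L0 P ℝ} (hC : IsStrictlyPos C)
    (hf : ∀ z, modulus (f z) ≤ C * finSup Q z) :
    f ∈ conjugateSpace P K (inducedTopology S) := by
  refine (@continuous_def _ _ (inducedTopology S) (scalarTopology P K) f).2 fun O hO x hx => ?_
  obtain ⟨ε, hε, h⟩ := hO (f x) hx
  refine ⟨Q, invL0 C * ε, hQ, ?_, fun z hz => ?_⟩
  · filter_upwards [hC, hε, coeFn_mul' (invL0 C) ε, coeFn_invL0 C] with ω h1 h2 h3 h4
    rw [h3, h4]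
    positivity
  · rw [Set.mem_preimage, map_add]
    refine h _ ((hf z).trans ?_)
    rw [le_iff_ae] at *
    filter_upwards [hC, hz, coeFn_mul' C (finSup Q z), coeFn_mul' (invL0 C) ε, coeFn_invL0 C]
      with ω h1 h2 h3 h4 h5
    rw [h4, h5] at h2
    rw [h3]
    rwa [inv_mul_eq_div, le_div_iff₀' h1] at h2

theorem isClosed_modulus_le_one : IsClosed[scalarTopology P K] {ξ : L0 P K | modulus ξ ≤ 1} := by
  refine (@isOpen_compl_iff _ _ (scalarTopology P K)).1 fun ξ hξ => ?_
  -- The radius is half the excess of `|ξ|` over `1` where there is one, and an arbitrary positive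
  -- value elsewhere.
  have hm : Measurable fun ω =>
      if 1 < modulus ξ ω then (modulus ξ ω - 1) / 2 else 1 :=
    Measurable.ite (measurableSet_lt measurable_const (modulus ξ).measurable)
      (((modulus ξ).measurable.sub_const 1).div_const 2) measurable_const
  refine ⟨AEEqFun.mk _ hm.aestronglyMeasurable, ?_, fun η hη hle => hξ ?_⟩
  · filter_upwards [AEEqFun.coeFn_mk _ hm.aestronglyMeasurable] with ω h
    rw [h]
    split_ifs with h1
    · linarith
    · exact one_pos
  · rw [Set.mem_ofPred_eq, le_one_iff_ae]
    filter_upwards [modulus_le_iff_ae.1 hη, modulus_le_one_iff_ae.1 hle,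
      AEEqFun.coeFn_mk _ hm.aestronglyMeasurable, coeFn_modulus ξ, coeFn_add' ξ η]
      with ω h1 h2 h3 h4 h5
    rw [h3] at h1
    rw [h5] at h2
    by_contra! h
    rw [if_pos h, h4] at h1
    rw [h4] at h
    have := norm_sub_le (ξ ω + η ω) (η ω)
    rw [add_sub_cancel_right] at this
    linarith

/-- The unit ball of `|f|` is balanced and convex, and locality of `|f|` carries the bound across
concatenations. -/
theorem ccHull_balancedConvexHull_subset (f : X →ₗ[L0 P K] L0 P K) {A : Set X}
    (hA : ∀ a ∈ A, modulus (f a) ≤ 1) :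
    ccHull P K (balancedConvexHull P K A) ⊆ {x | modulus (f x) ≤ 1} := by
  have hf := isSubseminorm_modulus_comp f
  have hΓ : balancedConvexHull P K A ⊆ {x | modulus (f x) ≤ 1} := by
    refine Set.sInter_subset_of_mem ⟨hA, fun η hη x hx => ?_, fun x hx y hy ξ h0 h1 => ?_⟩
    · exact (hf.smul_le η x).trans (mul_le_one₀ hη (modulus_nonneg _) hx)
    · have h1' : 0 ≤ 1 - ξ := sub_nonneg.2 h1
      refine ((hf.add_le _ _).trans (add_le_add (hf.smul_le _ _) (hf.smul_le _ _))).trans ?_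
      rw [← ofRealL0_one, ← ofRealL0_sub, modulus_ofRealL0_of_nonneg h0,
        modulus_ofRealL0_of_nonneg h1']
      refine (add_le_add (mul_le_of_le_one_right h0 hx) (mul_le_of_le_one_right h1' hy)).trans ?_
      rw [add_sub_cancel]
  rintro x ⟨B, u, hu, hx⟩
  rw [Set.mem_ofPred_eq, le_one_iff_ae]
  filter_upwards [ae_all_iff.2 fun n => hf.ae_le_of_ind_smul_eq (B.measurable n) (hx n),
    ae_all_iff.2 fun n => le_one_iff_ae.1 (hΓ (hu n))] with ω h1 h2
  obtain ⟨n, hn⟩ := Set.mem_iUnion.1 (B.iUnion_eq ▸ Set.mem_univ ω)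
  exact (h1 n hn).trans (h2 n)

end Seminorms

end RandomDuality

/-! ### The bipolar theorem -/

open RandomDuality in
theorem theorem3p26 {Ω : Type*} [MeasurableSpace Ω] (P : MeasureTheory.Measure Ω)
    [MeasureTheory.IsProbabilityMeasure P] {K : Type*} [RCLike K]
    {X : Type*} [AddCommGroup X] [Module (RandomDuality.L0 P K) X]
    {Y : Type*} [AddCommGroup Y] [Module (RandomDuality.L0 P K) Y]
    (b : X →ₗ[RandomDuality.L0 P K] Y →ₗ[RandomDuality.L0 P K] RandomDuality.L0 P K)
    (hb : RandomDuality.IsRandomDualityPair b)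
    (hX : RandomDuality.HasCountableConcatenation P K X)
    (A : Set X) (hA : A.Nonempty)
    (T : TopologicalSpace X) (hT : RandomDuality.IsRandomCompatible b T) :
    RandomDuality.polar b.flip (RandomDuality.polar b A) =
      closure[T] (RandomDuality.ccHull P K (RandomDuality.balancedConvexHull P K A)) := by
  obtain ⟨S, -, rfl, hS⟩ := hT
  have hAG : A ⊆ ccHull P K (balancedConvexHull P K A) :=
    (subset_balancedConvexHull A).trans (subset_ccHull _)
  apply Set.Subset.antisymm
  · intro x hx
    by_contra hxG
    rw [@mem_closure_iff _ (inducedTopology S)] at hxG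
    push Not at hxG
    obtain ⟨O, hO, hxO, hOG⟩ := hxG
    obtain ⟨Q, ε, hQ, hε, hball⟩ := hO x hxO
    obtain ⟨f, hfN, hfG, hfx⟩ := exists_linearMap_separating hX (hA.mono hAG)
      (isConcatenationStable_ccHull _)
      (isL0Balanced_ccHull (isL0Balanced_balancedConvexHull A))
      (isL0Convex_ccHull (isL0Convex_balancedConvexHull A)) (isSubseminorm_finSup Q) hε
      (x := x) (fun g hg hle => by
        -- The base neighbourhood consists of points `x + z`, so the sign of `x - g` has to be
        -- reversed.
        have hle' : finSup Q (g - x) ≤ ε := by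
          have := (isSubseminorm_finSup Q).smul_le (-1) (x - g)
          rw [neg_one_smul, neg_sub] at this
          refine this.trans ?_
          have h1 : modulus (-1 : L0 P K) ≤ 1 := by
            rw [modulus_le_one_iff_ae]
            filter_upwards [AEEqFun.coeFn_neg (1 : L0 P K), coeFn_one' (P := P) (K := K)]
              with ω h1 h2
            rw [h1, Pi.neg_apply, h2, norm_neg, norm_one]
          exact (mul_le_of_le_one_left (finSup_nonneg Q _) h1).trans hle
        have hgO := hball (g - x) hle'
        rw [add_sub_cancel] at hgO
        exact (hOG ▸ (⟨hgO, hg⟩ : g ∈ O ∩ _) : g ∈ (∅ : Set X)))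
    have hC : IsStrictlyPos (invL0 ε + invL0 ε) := by
      filter_upwards [hε, coeFn_add' (invL0 ε) (invL0 ε), coeFn_invL0 ε] with ω h1 h2 h3
      rw [h2, h3]
      positivity
    have hf := mem_conjugateSpace_of_modulus_le hQ hC hfN
    -- Compatibility turns the continuous `f` into a pairing with some `y`, which lies in the polar
    -- since `A ⊆ G`.
    rw [hS] at hf
    obtain ⟨y, rfl⟩ := hf
    exact hfx (hx y fun a ha => hfG a (hAG ha))
  · have hcl (y : Y) : IsClosed[inducedTopology S] {x | modulus (b.flip y x) ≤ 1} := by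
      have hy : b.flip y ∈ conjugateSpace P K (inducedTopology S) := by
        rw [hS]
        exact ⟨y, rfl⟩
      exact @IsClosed.preimage _ _ (inducedTopology S) (scalarTopology P K) _ hy _
        isClosed_modulus_le_one
    intro x hx y hy
    have hsub := @closure_minimal _ (inducedTopology S) _ _
      (ccHull_balancedConvexHull_subset (b.flip y) hy) (hcl y)
    exact hsub hx
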